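/- Notation. For a function $u:O\to Q$ write $u^*:Set/Q\to Set/O$ for pulling back along $u$ and $u_!:Set/O\to Set/Q$ for its left adjoint, composition with $u$. The exponential fibration $p_{exp}:Exp(Set)\to Set$ has as objects over a set $O$ the endofunctors $P$ of $Set/O$; a morphism from $P:Set/O\to Set/O$ to $R:Set/Q\to Set/Q$ over $u:O\to Q$ is a natural transformation $P\,u^*\to u^*R$, and $\sigma:R\,w^*\to w^*S$ after $\tau:P\,u^*\to u^*R$ is $P(wu)^*\cong P u^*w^*\to u^*Rw^*\to u^*w^*S\cong (wu)^*S$. It is a lax monoidal fibration: the tensor of objects over $O$ is composition of functors, the tensor of $\sigma:P u^*\to u^*R$ and $\tau:P'u^*\to u^*R'$ is $P P'u^*\to P u^*R'\to u^*R R'$, and the unit is the identity functor. A symmetric signature over a set $O$ is a family of sets $(A_n)_{n\ge 0}$ with right actions of the symmetric groups $S_n$ together with typings $\partial_a:\{0,1,\dots,n\}\to O$ for $a\in A_n$, such that $\partial_{a\cdot\sigma}=\partial_a\circ\sigma$, where $\sigma\in S_n$ fixes $0$. A morphism $(f,u):A\to B$ over $u:O\to Q$ is a family of equivariant maps $f_n:A_n\to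 B_n$ with $\partial_{f(a)}=u\circ\partial_a$. The signature $A$ acts on $d:X\to O$: the set $A\star X$ consists of the classes $[a,\vec x]$ of pairs with $a\in A_n$, $\vec x:\{1,\dots,n\}\to X$, $\partial_a(i)=d(\vec x(i))$ for $1\le i\le n$, modulo $(a,\vec x)\sim(a\cdot\sigma,\vec x\circ\sigma)$, and it lies over $O$ through $[a,\vec x]\mapsto\partial_a(0)$. The functor $rep_s:Sig_s\to Exp(Set)$ over $Set$ sends $A$ to $A\star(-):Set/O\to Set/O$ and $(f,u)$ to the transformation $A\star u^*(Y)\to u^*(B\star Y)$, $[a,\vec x]\mapsto(\partial_a(0),[f(a),\pi_Y\circ\vec x])$, where $\pi_Y:u^*(Y)\to Y$ is the projection. The fibration $p_{an}:An\to Set$ of multivariable analytic endofunctors is the essential image of $rep_s$ in $Exp(Set)$. A functor weakly preserves wide pullbacks if it sends (small) wide pullbacks to weak wide pullbacks (weak limits: a factorization exists, not necessarily a unique one); it is finitary if it preserves filtered colimits; a natural transformation is weakly cartesian if all its naturality squares are weak pullbacks. Theorem. The lax monoidal fibration $p_{an}:An\to Set$ has as objects the finitary endofunctors of the categories $Set/O$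 that weakly preserve wide pullbacks, and as morphisms the weakly cartesian natural transformations between them. In detail: (1) For every set $O$, an endofunctor $F$ of $Set/O$ is isomorphic to $A\star(-)$ for some symmetric signature $A$ over $O$ if and only if $F$ is finitary and weakly preserves wide pullbacks; equally, an object of $Exp(Set)$ lies in the essential image of $rep_s$ if and only if it has these two properties. (2) For symmetric signatures $A$ over $O$ and $B$ over $Q$ and $u:O\to Q$, a natural transformation $A\star u^*(-)\to u^*(B\star(-))$ is of the form $rep_s(f,u)$ for a morphism $(f,u):A\to B$ if and only if it is weakly cartesian; and a morphism $\tau:P u^*\to u^*R$ of $Exp(Set)$ lies in the essential image of $rep_s$ (is isomorphic, as an arrow of $Exp(Set)$, to some $rep_s(f,u')$) if and only if $P$ and $R$ are finitary and weakly preserve wide pullbacks and $\tau$ is weakly cartesian. (3) $An$ is a subcategory of $Exp(Set)$ to which the structure of lax monoidal fibration restricts: for every $R$ in $An$ over $Q$ and every $u:O\to Q$ there is a prone (strongly cartesian) morphism of $Exp(Set)$ over $u$ with codomain $R$ that lies in $An$ and through which morphisms of $An$ factor only by morphisms of $An$, and $An$ is closed under tensors of objects and of morphisms and contains the unit objects $id_{Set/O}$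 and the unit morphisms $id_{u^*}$. -/

import Mathlib

open CategoryTheory CategoryTheory.Limits

universe u

namespace MultiAnalytic

/-! ## Pulling back along a function -/

/-- The pullback functor `u^* : Set/Q ⥤ Set/O` along `u : O ⟶ Q`, with the usual explicit
pullbacks of sets `{(o, y) | u o = d^Y y}`. -/
def reindex {O Q : Type u} (v : O ⟶ Q) : Over Q ⥤ Over O where
  obj Y := Over.mk (Y := Types.PullbackObj v Y.hom) (↾fun p => p.1.1)
  map {Y Y'} g := Over.homMk
    (↾fun p => ⟨(p.1.1, g.left p.1.2), 
      p.2.trans (ConcreteCategory.congr_hom (Over.w g) p.1.2).symm⟩) (by ext; rfl)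
  map_id Y := by ext; rfl
  map_comp f g := by ext; rfl

/-- `u^*` is right adjoint to composition with `u`, the functor `u_! : Set/O ⥤ Set/Q`. -/
def reindexAdj {O Q : Type u} (v : O ⟶ Q) : Over.map v ⊣ reindex v :=
  Adjunction.mkOfUnitCounit
    { unit :=
        { app X := Over.homMk (↾fun x => ⟨(X.hom x, x), rfl⟩) (by ext; rfl)
          naturality X Y f := by
            ext x
            refine Subtype.ext (Prod.ext ?_ rfl)
            exact ConcreteCategory.congr_hom (Over.w f) x }
      counit :=
        { app Y := Over.homMk (↾fun p => p.1.2) (by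
            ext p
            exact p.2.symm)
          naturality X Y f := by ext; rfl }
      left_triangle := by ext; rfl
      right_triangle := by ext; rfl }

/-- The canonical isomorphism `(𝟙_O)^* ≅ 𝟭`. -/
def reindexId (O : Type u) : reindex (𝟙 O) ≅ 𝟭 (Over O) where
  hom :=
    { app Y := Over.homMk (↾fun p => p.1.2) (by ext p; exact p.2.symm)
      naturality X Y f := by ext; rfl }
  inv :=
    { app Y := Over.homMk (↾fun y => ⟨(Y.hom y, y), rfl⟩) (by ext; rfl)
      naturality X Y f := by
        ext x
        refine Subtype.ext (Prod.ext ?_ rfl)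
        exact ConcreteCategory.congr_hom (Over.w f) x }
  hom_inv_id := by
    ext Y p
    refine Subtype.ext (Prod.ext ?_ rfl)
    exact p.2.symm
  inv_hom_id := by ext; rfl

/-- The canonical isomorphism `(w ∘ v)^* ≅ v^* ∘ w^*`. -/
def reindexComp {O P Q : Type u} (v : O ⟶ P) (w : P ⟶ Q) :
    reindex (v ≫ w) ≅ reindex w ⋙ reindex v where
  hom :=
    { app Y := Over.homMk (↾fun p => ⟨(p.1.1, ⟨(v p.1.1, p.1.2), p.2⟩), rfl⟩) (by ext; rfl)
      naturality X Y f := by ext; rfl }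
  inv :=
    { app Y := Over.homMk (↾fun p => ⟨(p.1.1, p.1.2.1.2), by
          have h1 := p.2
          have h2 := p.1.2.2
          change w (v p.1.1) = _
          rw [← h2]
          exact congrArg w h1⟩) (by ext; rfl)
      naturality X Y f := by ext; rfl }
  hom_inv_id := by ext; rfl
  inv_hom_id := by
    ext Y p
    refine Subtype.ext (Prod.ext rfl (Subtype.ext (Prod.ext ?_ rfl)))
    exact p.2

/-! ## The exponential fibration -/

/-- An object of the exponential fibration `Exp(Set)`: a set `O` and an endofunctor
of `Set/O`. -/
structure ExpSet : Type (u + 1) where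
  base : Type u
  functor : Over base ⥤ Over base

/-- A morphism `P ⟶ R` of `Exp(Set)` over `v : O ⟶ Q`: a natural transformation
`P v^* ⟶ v^* R` of functors `Set/Q ⥤ Set/O`. -/
structure ExpSet.Hom (P R : ExpSet.{u}) : Type (u + 1) where
  base : P.base ⟶ R.base
  nat : reindex base ⋙ P.functor ⟶ R.functor ⋙ reindex base

namespace ExpSet

/-- The identity of `P`, lying over the identity function. -/
def Hom.id (P : ExpSet.{u}) : Hom P P where
  base := 𝟙 P.base
  nat := Functor.whiskerRight (reindexId P.base).hom P.functor ≫
    Functor.whiskerLeft P.functor (reindexId P.base).inv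

/-- The composite of `τ : P v^* ⟶ v^* R` and `σ : R w^* ⟶ w^* S` is
`P (w v)^* ≅ P v^* w^* ⟶ v^* R w^* ⟶ v^* w^* S ≅ (w v)^* S`. -/
def Hom.comp {P R S : ExpSet.{u}} (τ : Hom P R) (σ : Hom R S) : Hom P S where
  base := τ.base ≫ σ.base
  nat := Functor.whiskerRight (reindexComp τ.base σ.base).hom P.functor ≫
    Functor.whiskerLeft (reindex σ.base) τ.nat ≫
    Functor.whiskerRight σ.nat (reindex τ.base) ≫
    Functor.whiskerLeft S.functor (reindexComp τ.base σ.base).inv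


instance : Category ExpSet.{u} where
  Hom := Hom
  id := Hom.id
  comp := Hom.comp
  id_comp {P R} τ := by
    obtain ⟨v, τ⟩ := τ
    change Hom.mk v _ = Hom.mk v _
    congr 1
    ext1
    ext1 Y
    have h : P.functor.map ((reindexComp (𝟙 P.base) v).hom.app Y) ≫
        P.functor.map ((reindexId P.base).hom.app ((reindex v).obj Y)) = 𝟙 _ := by
      rw [← P.functor.map_comp, ← P.functor.map_id]
      congr 1
    change P.functor.map ((reindexComp (𝟙 P.base) v).hom.app Y) ≫
      (P.functor.map ((reindexId P.base).hom.app ((reindex v).obj Y)) ≫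
        (reindexId P.base).inv.app (P.functor.obj ((reindex v).obj Y))) ≫
      (reindex (𝟙 P.base)).map (τ.app Y) ≫
      (reindexComp (𝟙 P.base) v).inv.app (R.functor.obj Y) = τ.app Y
    rw [Category.assoc, reassoc_of% h]
    ext x
    have e : ∀ y : (P.functor.obj ((reindex v).obj Y)).left,
        (P.functor.obj ((reindex v).obj Y)).hom y =
          ((reindex v).obj (R.functor.obj Y)).hom ((τ.app Y).left y) :=
      fun y => (ConcreteCategory.congr_hom (Over.w (τ.app Y)) y).symm
    exact Subtype.ext (Prod.ext (e x) rfl)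
  comp_id {P R} τ := by
    obtain ⟨v, τ⟩ := τ
    change Hom.mk v _ = Hom.mk v _
    congr 1
    ext1
    ext1 Y
    have n := τ.naturality ((reindexId R.base).hom.app Y)
    change P.functor.map ((reindexComp v (𝟙 R.base)).hom.app Y) ≫
      τ.app ((reindex (𝟙 R.base)).obj Y) ≫
      (reindex v).map (R.functor.map ((reindexId R.base).hom.app Y) ≫
        (reindexId R.base).inv.app (R.functor.obj Y)) ≫
      (reindexComp v (𝟙 R.base)).inv.app (R.functor.obj Y) = τ.app Y
    change P.functor.map ((reindex v).map ((reindexId R.base).hom.app Y)) ≫ τ.app Y =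
      τ.app _ ≫ (reindex v).map (R.functor.map ((reindexId R.base).hom.app Y)) at n
    have h : P.functor.map ((reindexComp v (𝟙 R.base)).hom.app Y) ≫
        P.functor.map ((reindex v).map ((reindexId R.base).hom.app Y)) = 𝟙 _ := by
      rw [← P.functor.map_comp, ← P.functor.map_id]
      congr 1
    rw [Functor.map_comp, Category.assoc, ← reassoc_of% n, reassoc_of% h]
    ext; rfl
  assoc {P R S T} τ σ ρ := by
    obtain ⟨v, τ⟩ := τ
    obtain ⟨w, σ⟩ := σ
    obtain ⟨z, ρ⟩ := ρ
    change Hom.mk (v ≫ w ≫ z) _ = Hom.mk (v ≫ w ≫ z) _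
    congr 1
    ext1
    ext1 Y
    have n := τ.naturality ((reindexComp w z).hom.app Y)
    change P.functor.map ((reindex v).map ((reindexComp w z).hom.app Y)) ≫
      τ.app ((reindex w).obj ((reindex z).obj Y)) =
      τ.app ((reindex (w ≫ z)).obj Y) ≫
        (reindex v).map (R.functor.map ((reindexComp w z).hom.app Y)) at n
    have h : P.functor.map ((reindexComp (v ≫ w) z).hom.app Y) ≫
        P.functor.map ((reindexComp v w).hom.app ((reindex z).obj Y)) =
        P.functor.map ((reindexComp v (w ≫ z)).hom.app Y) ≫
          P.functor.map ((reindex v).map ((reindexComp w z).hom.app Y)) := by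
      rw [← P.functor.map_comp, ← P.functor.map_comp]
      congr 1
    change P.functor.map ((reindexComp (v ≫ w) z).hom.app Y) ≫
      (P.functor.map ((reindexComp v w).hom.app ((reindex z).obj Y)) ≫
        τ.app ((reindex w).obj ((reindex z).obj Y)) ≫
        (reindex v).map (σ.app ((reindex z).obj Y)) ≫
        (reindexComp v w).inv.app (S.functor.obj ((reindex z).obj Y))) ≫
      (reindex (v ≫ w)).map (ρ.app Y) ≫
      (reindexComp (v ≫ w) z).inv.app (T.functor.obj Y) =
      P.functor.map ((reindexComp v (w ≫ z)).hom.app Y) ≫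
        τ.app ((reindex (w ≫ z)).obj Y) ≫
        (reindex v).map (R.functor.map ((reindexComp w z).hom.app Y) ≫
          σ.app ((reindex z).obj Y) ≫ (reindex w).map (ρ.app Y) ≫
          (reindexComp w z).inv.app (T.functor.obj Y)) ≫
        (reindexComp v (w ≫ z)).inv.app (T.functor.obj Y)
    simp only [Functor.map_comp, Category.assoc]
    rw [← reassoc_of% n, reassoc_of% h]
    ext; rfl

/-- The morphism of `Exp(Set)` given by a natural transformation `P v^* ⟶ v^* R`. -/
def homMk {O Q : Type u} {P : Over O ⥤ Over O} {R : Over Q ⥤ Over Q} (v : O ⟶ Q)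
    (τ : reindex v ⋙ P ⟶ R ⋙ reindex v) : (⟨O, P⟩ : ExpSet.{u}) ⟶ ⟨Q, R⟩ :=
  Hom.mk (P := ⟨O, P⟩) (R := ⟨Q, R⟩) v τ

/-- The natural transformation `P v^* ⟶ v^* R` underlying a morphism of `Exp(Set)`. -/
abbrev nat {P R : ExpSet.{u}} (τ : P ⟶ R) :
    reindex (Hom.base τ) ⋙ P.functor ⟶ R.functor ⋙ reindex (Hom.base τ) :=
  Hom.nat τ

/-- The projection `p_exp : Exp(Set) ⥤ Set`. -/
def proj : ExpSet.{u} ⥤ Type u where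
  obj P := P.base
  map τ := Hom.base τ
  map_id _ := rfl
  map_comp _ _ := rfl

/-! ### The monoidal structure of the fibres -/

/-- The tensor product in the fibre over `O`: the composite `P ∘ P'`. -/
def tensorObj {O : Type u} (P P' : Over O ⥤ Over O) : ExpSet.{u} := ⟨O, P' ⋙ P⟩

/-- The tensor product over `v` of `σ : P v^* ⟶ v^* R` and `τ : P' v^* ⟶ v^* R'`:
`P P' v^* ⟶ P v^* R' ⟶ v^* R R'`. -/
def tensorHom {O Q : Type u} (v : O ⟶ Q) {P P' : Over O ⥤ Over O} {R R' : Over Q ⥤ Over Q}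
    (σ : reindex v ⋙ P ⟶ R ⋙ reindex v) (τ : reindex v ⋙ P' ⟶ R' ⋙ reindex v) :
    tensorObj P P' ⟶ tensorObj R R' :=
  homMk v (Functor.whiskerRight τ P ≫ Functor.whiskerLeft R' σ)

/-- The unit of the fibre over `O`: the identity functor of `Set/O`. -/
def unitObj (O : Type u) : ExpSet.{u} := ⟨O, 𝟭 (Over O)⟩

/-- The value `I_v : I_O ⟶ I_Q` of the unit on a function `v : O ⟶ Q`. -/
def unitHom {O Q : Type u} (v : O ⟶ Q) : unitObj O ⟶ unitObj Q :=
  homMk v (𝟙 (reindex v))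

/-- The tensor product preserves identities. -/
theorem tensorHom_id {O : Type u} (P P' : Over O ⥤ Over O) :
    tensorHom (𝟙 O) (nat (𝟙 (⟨O, P⟩ : ExpSet.{u}))) (nat (𝟙 (⟨O, P'⟩ : ExpSet.{u}))) =
      𝟙 (tensorObj P P') := by
  refine congrArg (homMk (P := P' ⋙ P) (R := P' ⋙ P) (𝟙 O)) ?_
  ext1
  ext1 Y
  change P.map (P'.map ((reindexId O).hom.app Y) ≫ (reindexId O).inv.app (P'.obj Y)) ≫
    P.map ((reindexId O).hom.app (P'.obj Y)) ≫ (reindexId O).inv.app (P.obj (P'.obj Y)) =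
    P.map (P'.map ((reindexId O).hom.app Y)) ≫ (reindexId O).inv.app (P.obj (P'.obj Y))
  rw [← Category.assoc, ← P.map_comp, Category.assoc, Iso.inv_hom_id_app]
  rfl

/-- The tensor product preserves composition. -/
theorem tensorHom_comp {O Q T : Type u} (v : O ⟶ Q) (w : Q ⟶ T) {P P' : Over O ⥤ Over O}
    {R R' : Over Q ⥤ Over Q} {S S' : Over T ⥤ Over T}
    (σ : reindex v ⋙ P ⟶ R ⋙ reindex v) (τ : reindex v ⋙ P' ⟶ R' ⋙ reindex v)
    (σ' : reindex w ⋙ R ⟶ S ⋙ reindex w) (τ' : reindex w ⋙ R' ⟶ S' ⋙ reindex w) :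
    tensorHom (v ≫ w) (nat (homMk v σ ≫ homMk w σ')) (nat (homMk v τ ≫ homMk w τ')) =
      tensorHom v σ τ ≫ tensorHom w σ' τ' := by
  refine congrArg (homMk (P := P' ⋙ P) (R := S' ⋙ S) (v ≫ w)) ?_
  ext1
  ext1 Y
  have n := σ.naturality (τ'.app Y)
  change P.map ((reindex v).map (τ'.app Y)) ≫ σ.app ((reindex w).obj (S'.obj Y)) =
    σ.app (R'.obj ((reindex w).obj Y)) ≫ (reindex v).map (R.map (τ'.app Y)) at n
  change P.map (P'.map ((reindexComp v w).hom.app Y) ≫ τ.app ((reindex w).obj Y) ≫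
      (reindex v).map (τ'.app Y) ≫ (reindexComp v w).inv.app (S'.obj Y)) ≫
    P.map ((reindexComp v w).hom.app (S'.obj Y)) ≫ σ.app ((reindex w).obj (S'.obj Y)) ≫
      (reindex v).map (σ'.app (S'.obj Y)) ≫ (reindexComp v w).inv.app (S.obj (S'.obj Y)) =
    P.map (P'.map ((reindexComp v w).hom.app Y)) ≫
      (P.map (τ.app ((reindex w).obj Y)) ≫ σ.app (R'.obj ((reindex w).obj Y))) ≫
      (reindex v).map (R.map (τ'.app Y) ≫ σ'.app (S'.obj Y)) ≫
      (reindexComp v w).inv.app (S.obj (S'.obj Y))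
  have h : P.map ((reindexComp v w).inv.app (S'.obj Y)) ≫
      P.map ((reindexComp v w).hom.app (S'.obj Y)) = 𝟙 _ := by
    rw [← P.map_comp, Iso.inv_hom_id_app, P.map_id]
  simp only [Functor.map_comp, Category.assoc]
  rw [← reassoc_of% n, reassoc_of% h]

/-- The tensor product is strictly associative. -/
theorem tensorHom_assoc {O Q : Type u} (v : O ⟶ Q) {P P' P'' : Over O ⥤ Over O}
    {R R' R'' : Over Q ⥤ Over Q} (σ : reindex v ⋙ P ⟶ R ⋙ reindex v)
    (τ : reindex v ⋙ P' ⟶ R' ⋙ reindex v) (ρ : reindex v ⋙ P'' ⟶ R'' ⋙ reindex v) :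
    tensorHom v σ (nat (tensorHom v τ ρ)) = tensorHom v (nat (tensorHom v σ τ)) ρ := by
  refine congrArg (homMk (P := P'' ⋙ P' ⋙ P) (R := R'' ⋙ R' ⋙ R) v) ?_
  ext1
  ext1 Y
  change P.map (P'.map (ρ.app Y) ≫ τ.app (R''.obj Y)) ≫ σ.app (R'.obj (R''.obj Y)) =
    P.map (P'.map (ρ.app Y)) ≫ P.map (τ.app (R''.obj Y)) ≫ σ.app (R'.obj (R''.obj Y))
  rw [P.map_comp, Category.assoc]

/-- The unit is a strict right unit. -/
theorem tensorHom_unit {O Q : Type u} (v : O ⟶ Q) {P : Over O ⥤ Over O} {R : Over Q ⥤ Over Q}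
    (σ : reindex v ⋙ P ⟶ R ⋙ reindex v) :
    tensorHom v σ (nat (unitHom v)) = homMk v σ := by
  refine congrArg (homMk (P := P) (R := R) v) ?_
  ext1
  ext1 Y
  change P.map (𝟙 _) ≫ σ.app Y = σ.app Y
  rw [P.map_id, Category.id_comp]

/-- The unit is a strict left unit. -/
theorem unit_tensorHom {O Q : Type u} (v : O ⟶ Q) {P : Over O ⥤ Over O} {R : Over Q ⥤ Over Q}
    (σ : reindex v ⋙ P ⟶ R ⋙ reindex v) :
    tensorHom v (nat (unitHom v)) σ = homMk v σ := by
  refine congrArg (homMk (P := P) (R := R) v) ?_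
  ext1
  ext1 Y
  change σ.app Y ≫ 𝟙 _ = σ.app Y
  rw [Category.comp_id]

end ExpSet

/-! ## Symmetric signatures -/

/-- A symmetric signature on the set of types `O`: operations `op n` of arity `n` with a right
action of the symmetric group, and an equivariant typing `∂_a : {0, …, n} → O` (permutations fix
`0`), split into the output type `out a = ∂_a 0` and the input types `inp a i = ∂_a i`, `1 ≤ i ≤ n`. -/
structure SymSig (O : Type u) : Type (u + 1) where
  op : ℕ → Type u
  act : ∀ {n : ℕ}, op n → Equiv.Perm (Fin n) → op n
  act_one : ∀ {n : ℕ} (a : op n), act a 1 = a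
  act_mul : ∀ {n : ℕ} (a : op n) (σ τ : Equiv.Perm (Fin n)), act a (σ * τ) = act (act a σ) τ
  out : ∀ {n : ℕ}, op n → O
  inp : ∀ {n : ℕ}, op n → Fin n → O
  out_act : ∀ {n : ℕ} (a : op n) (σ : Equiv.Perm (Fin n)), out (act a σ) = out a
  inp_act : ∀ {n : ℕ} (a : op n) (σ : Equiv.Perm (Fin n)), inp (act a σ) = inp a ∘ σ

namespace SymSig

/-- A morphism of symmetric signatures over a function `v : O ⟶ Q`. -/
@[ext]
structure HomOver {O Q : Type u} (v : O ⟶ Q) (A : SymSig O) (B : SymSig Q) : Type u where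
  toFun : ∀ {n : ℕ}, A.op n → B.op n
  map_act : ∀ {n : ℕ} (a : A.op n) (σ : Equiv.Perm (Fin n)),
    toFun (A.act a σ) = B.act (toFun a) σ
  out_map : ∀ {n : ℕ} (a : A.op n), B.out (toFun a) = v (A.out a)
  inp_map : ∀ {n : ℕ} (a : A.op n), B.inp (toFun a) = v ∘ A.inp a

/-! ### The action on slices -/

variable {O Q : Type u}

/-- The pairs `(a, x)` with `a` an operation of arity `n` and `x : {1, …, n} → X` a tuple whose types are the
input types of `a`. -/
def Pre (A : SymSig O) (X : Over O) (n : ℕ) : Type u :=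
  { p : A.op n × (Fin n → X.left) // A.inp p.1 = X.hom ∘ p.2 }

/-- `(a, x) ~ (a · σ, x ∘ σ)`. -/
def preSetoid (A : SymSig O) (X : Over O) (n : ℕ) : Setoid (Pre A X n) where
  r p q := ∃ σ : Equiv.Perm (Fin n), q.1 = (A.act p.1.1 σ, p.1.2 ∘ σ)
  iseqv :=
    { refl := fun p => ⟨1, by rw [A.act_one]; rfl⟩
      symm := by
        rintro ⟨⟨a, x⟩, hp⟩ ⟨⟨b, y⟩, hq⟩ ⟨σ, h⟩
        obtain ⟨rfl, rfl⟩ := Prod.mk.inj h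
        refine ⟨σ⁻¹, Prod.ext ?_ ?_⟩
        · change a = A.act (A.act a σ) σ⁻¹
          rw [← A.act_mul, mul_inv_cancel, A.act_one]
        · funext i
          exact congrArg x (σ.apply_symm_apply i).symm
      trans := by
        rintro ⟨⟨a, x⟩, hp⟩ ⟨⟨b, y⟩, hq⟩ ⟨⟨c, z⟩, hr⟩ ⟨σ, h⟩ ⟨τ, h'⟩
        obtain ⟨rfl, rfl⟩ := Prod.mk.inj h
        obtain ⟨rfl, rfl⟩ := Prod.mk.inj h'
        exact ⟨σ * τ, Prod.ext (A.act_mul a σ τ).symm rfl⟩ }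

/-- The set `A ⋆ X`; as `~` preserves the arity, it is the disjoint union over the arities of
the quotients by `~`. -/
def Star (A : SymSig O) (X : Over O) : Type u :=
  Σ n : ℕ, Quotient (preSetoid A X n)

/-- The element `[a, x]` of `A ⋆ X`. -/
def Star.mk {A : SymSig O} {X : Over O} {n : ℕ} (a : A.op n) (x : Fin n → X.left)
    (h : A.inp a = X.hom ∘ x) : Star A X :=
  ⟨n, Quotient.mk (preSetoid A X n) ⟨(a, x), h⟩⟩

/-- The function `A ⋆ X → O`, `[a, x] ↦ ∂_a 0`. -/
def Star.out {A : SymSig O} {X : Over O} (s : Star A X) : O :=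
  Quotient.lift (s := preSetoid A X s.1) (fun p => A.out p.1.1) (by
    rintro p q ⟨σ, h⟩
    rw [h]
    exact (A.out_act _ _).symm) s.2

/-- For a morphism of signatures `f : A ⟶ B` over `v` and a function `g : X → Y` over `v`, the function
`A ⋆ X → B ⋆ Y`, `[a, x] ↦ [f a, g ∘ x]`. -/
def Star.map {v : O ⟶ Q} {A : SymSig O} {B : SymSig Q} (f : HomOver v A B)
    {X : Over O} {Y : Over Q} (g : X.left → Y.left) (hg : ∀ x, Y.hom (g x) = v (X.hom x))
    (s : Star A X) : Star B Y :=
  ⟨s.1, Quotient.map' (s₁ := preSetoid A X s.1) (s₂ := preSetoid B Y s.1)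
    (fun p => ⟨(f.toFun p.1.1, g ∘ p.1.2), by
      rw [f.inp_map, p.2]
      funext i
      exact (hg _).symm⟩)
    (by
      rintro p q ⟨σ, h⟩
      refine ⟨σ, ?_⟩
      change (f.toFun q.1.1, g ∘ q.1.2) = _
      rw [h]
      exact Prod.ext (f.map_act _ _) rfl) s.2⟩

/-- The identity morphism of a symmetric signature. -/
def HomOver.id (A : SymSig O) : HomOver (𝟙 O) A A where
  toFun a := a
  map_act _ _ := rfl
  out_map _ := rfl
  inp_map _ := rfl

/-- The composite of morphisms of symmetric signatures over `v` and over `w`. -/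
def HomOver.comp {P : Type u} {v : O ⟶ P} {w : P ⟶ Q} {A : SymSig O} {B : SymSig P} {C : SymSig Q}
    (f : HomOver v A B) (g : HomOver w B C) : HomOver (v ≫ w) A C where
  toFun a := g.toFun (f.toFun a)
  map_act a σ := by rw [f.map_act, g.map_act]
  out_map a := by rw [g.out_map, f.out_map]; rfl
  inp_map a := by rw [g.inp_map, f.inp_map]; rfl

/-- The endofunctor `A ⋆ (-)` of `Set/O`. -/
def star (A : SymSig O) : Over O ⥤ Over O where
  obj X := Over.mk (Y := Star A X) (↾Star.out)
  map {X Y} g := Over.homMk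
    (↾(Star.map (HomOver.id A) g.left (fun x => ConcreteCategory.congr_hom (Over.w g) x)))
    (by
      ext ⟨n, s⟩
      induction s using Quotient.inductionOn
      rfl)
  map_id X := by
    ext ⟨n, s⟩
    induction s using Quotient.inductionOn
    rfl
  map_comp f g := by
    ext ⟨n, s⟩
    induction s using Quotient.inductionOn
    rfl

/-- The natural transformation `A ⋆ v^*(-) ⟶ v^*(B ⋆ (-))` given by a morphism `f : A ⟶ B` over `v`,
`[a, x] ↦ (∂_a 0, [f a, v^Y ∘ x])`, where `v^Y : v^* Y → Y` is the projection. -/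
def starHom {v : O ⟶ Q} {A : SymSig O} {B : SymSig Q} (f : HomOver v A B) :
    reindex v ⋙ star A ⟶ star B ⋙ reindex v where
  app Y := Over.homMk
    (↾fun s => ⟨(Star.out s,
        Star.map (X := (reindex v).obj Y) f (fun p => p.1.2) (fun p => p.2.symm) s), by
      obtain ⟨n, s⟩ := s
      induction s using Quotient.inductionOn
      exact (f.out_map _).symm⟩)
    (by ext; rfl)
  naturality Y Y' g := by
    ext ⟨n, s⟩
    induction s using Quotient.inductionOn
    rfl

end SymSig

/-- The total category of symmetric signatures: a set of types and a symmetric signature on it. -/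
structure Sig : Type (u + 1) where
  base : Type u
  sig : SymSig base

namespace Sig

/-- A morphism of symmetric signatures: a function of the sets of types and a morphism over it. -/
structure Hom (A B : Sig.{u}) : Type u where
  base : A.base ⟶ B.base
  hom : SymSig.HomOver base A.sig B.sig

instance : Category Sig.{u} where
  Hom := Hom
  id A := ⟨𝟙 A.base, SymSig.HomOver.id A.sig⟩
  comp f g := ⟨f.base ≫ g.base, f.hom.comp g.hom⟩
  id_comp _ := rfl
  comp_id _ := rfl
  assoc _ _ _ := rfl

/-- The representation `rep_s : Sig_s ⥤ Exp(Set)` of symmetric signatures. -/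
def rep : Sig.{u} ⥤ ExpSet.{u} where
  obj A := ⟨A.base, A.sig.star⟩
  map {A B} f := ExpSet.homMk f.base (SymSig.starHom f.hom)
  map_id A := by
    refine congrArg (ExpSet.homMk (P := A.sig.star) (R := A.sig.star) (𝟙 A.base)) ?_
    ext Y ⟨n, s⟩
    induction s using Quotient.inductionOn
    rfl
  map_comp {A B C} f g := by
    refine congrArg
      (ExpSet.homMk (P := A.sig.star) (R := C.sig.star) (f.base ≫ g.base)) ?_
    ext Y ⟨n, s⟩
    induction s using Quotient.inductionOn
    rfl

end Sig

/-! ## The fibration of analytic functors and its properties -/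

/-- An endofunctor of `Set/O` is analytic if it is isomorphic to `A ⋆ (-)` for some symmetric
signature `A` on `O`. -/
def IsAnalytic {O : Type u} (F : Over O ⥤ Over O) : Prop :=
  ∃ A : SymSig O, Nonempty (A.star ≅ F)

/-- The objects of `An`: the essential image of `rep_s` on objects. -/
def AnObj : ObjectProperty ExpSet.{u} := Sig.rep.essImage

/-- The morphisms of `An`: the essential image of `rep_s` on morphisms, that is, the morphisms of
`Exp(Set)` which are isomorphic, as arrows, to some `rep_s (f)`. -/
def AnHom : MorphismProperty ExpSet.{u} := (⊤ : MorphismProperty Sig.{u}).map Sig.rep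

/-- A functor weakly preserves wide pullbacks if it sends the limit cones of all (small) wide
cospans to weak limit cones. -/
def WeaklyPreservesWidePullbacks {O Q : Type u} (F : Over O ⥤ Over Q) : Prop :=
  ∀ (J : Type u) (K : WidePullbackShape J ⥤ Over O) (c : Cone K),
    IsLimit c → Nonempty (IsWeakLimit (F.mapCone c))

/-- Finitary endofunctors of `Set/O`, those which preserve filtered colimits, that weakly preserve
wide pullbacks. -/
structure IsFinitaryWeaklyWide {O : Type u} (F : Over O ⥤ Over O) : Prop where
  finitary : PreservesFilteredColimitsOfSize.{u, u} F
  wide : WeaklyPreservesWidePullbacks F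

/-- A natural transformation is weakly cartesian if all its naturality squares are weak
pullbacks. -/
def WeaklyCartesian {C D : Type*} [Category* C] [Category* D] {F G : C ⥤ D} (α : F ⟶ G) : Prop :=
  ∀ ⦃X Y : C⦄ (f : X ⟶ Y),
    Nonempty (IsWeakLimit (PullbackCone.mk (F.map f) (α.app X) (α.naturality f)))

/-- A class `S` of objects and a class `W` of morphisms of `Exp(Set)` form a subcategory to which
the whole structure of lax monoidal fibration of `Exp(Set) ⥤ Set` restricts. The coherence
transformations of `Exp(Set)` are identities, because composition of functors is strictly
associative and unital. -/
structure IsLaxMonoidalSubfibration (S : ObjectProperty ExpSet.{u})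
    (W : MorphismProperty ExpSet.{u}) : Prop where
  source : ∀ {P R : ExpSet.{u}} (τ : P ⟶ R), W τ → S P
  target : ∀ {P R : ExpSet.{u}} (τ : P ⟶ R), W τ → S R
  id_mem : ∀ P : ExpSet.{u}, S P → W (𝟙 P)
  comp_mem : ∀ {P R T : ExpSet.{u}} (τ : P ⟶ R) (σ : R ⟶ T), W τ → W σ → W (τ ≫ σ)
  -- Prone (strongly cartesian) lifts lie in the subcategory and stay prone there.
  prone : ∀ (R : ExpSet.{u}), S R → ∀ (O : Type u) (v : O ⟶ R.base),
    ∃ (P : ExpSet.{u}) (φ : P ⟶ R), ExpSet.proj.IsStronglyCartesian v φ ∧ W φ ∧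
      ∀ (T : ExpSet.{u}) (χ : T ⟶ P), W (χ ≫ φ) → W χ
  tensor_obj : ∀ {O : Type u} (P P' : Over O ⥤ Over O), S ⟨O, P⟩ → S ⟨O, P'⟩ →
    S (ExpSet.tensorObj P P')
  tensor_hom : ∀ {O Q : Type u} (v : O ⟶ Q) {P P' : Over O ⥤ Over O} {R R' : Over Q ⥤ Over Q}
    (σ : reindex v ⋙ P ⟶ R ⋙ reindex v) (τ : reindex v ⋙ P' ⟶ R' ⋙ reindex v),
    W (ExpSet.homMk v σ) → W (ExpSet.homMk v τ) → W (ExpSet.tensorHom v σ τ)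
  unit_obj : ∀ O : Type u, S (ExpSet.unitObj O)
  unit_hom : ∀ {O Q : Type u} (v : O ⟶ Q), W (ExpSet.unitHom v)

end MultiAnalytic

/-!
The elementwise description of weak limits in slices of `Set` is used throughout: a cone over a wide
cospan is a weak limit exactly if every compatible family of elements comes from its apex.

*Objects.* That `A ⋆ (-)` is finitary and weakly preserves wide pullbacks is read off from the
description by classes `[a, x]`: the operation can be fixed in all members of a compatible family, and
then only the finite tuples have to be lifted. Conversely, let `F` have these two properties. Call `y` in
`F Y` generic if every morphism into `(Y, y)` in the category of elements of `F` has a section. Every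
element `x` of `F X` is the image of a generic element at a finite object (`exists_isGeneric`): the finite
supports of `x` form a small compatible family, so that some element at their wide pullback lies
over all of them, and a finite support of that element is weakly initial among the finite supports
of `x`; one of least cardinality has only invertible endomorphisms over `x`, which makes it generic. Two
generic elements with the same image are isomorphic over it (`IsGeneric.exists_iso`). The generic
elements at the finite objects `{1, …, n}` therefore form a symmetric signature, `genericSig F`, whose
functor is isomorphic to `F` (`isAnalytic_iff`).

*Morphisms.* A transformation `A ⋆ v^*(-) ⟶ v^*(B ⋆ (-))` is determined by its values at the universal elements
`[a, (1, …, n)]`. If it is weakly cartesian, each of these values is `[b, (1, …, n)]` for a unique operation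
`b` (`exists_op_of_weaklyCartesian`), and `a ↦ b` is the required morphism of signatures. For the
essential image, isomorphisms of `Exp(Set)` are shown to be pointwise bijective transformations over
bijections (`bijective_nat_app`), so that both properties of functors and weak cartesianness are
invariant under them.

*Structure.* The prone morphism over `v` with codomain `R` is `v^* R v_! v^* ⟶ v^* R`, from the counit of
`v_! ⊣ v^*`. The functors `v_!` and `v^*` are finitary and weakly preserve wide pullbacks, and unit and
counit are cartesian; the remaining closure properties follow from the stability of weak pullbacks
under composition and under functors that weakly preserve wide pullbacks.
-/

namespace MultiAnalytic

/-! ### Elements of objects of a slice of `Set` -/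

section Elements

variable {O Q T : Type u}

theorem hom_left_apply {X Y : Over O} (f : X ⟶ Y) (x : X.left) : Y.hom (f.left x) = X.hom x :=
  ConcreteCategory.congr_hom (Over.w f) x

/-- The morphism of a slice given by a function that respects the projections. -/
def ofFun {X Y : Over O} (f : X.left → Y.left) (h : ∀ x, Y.hom (f x) = X.hom x) : X ⟶ Y :=
  Over.homMk (↾f) (by ext x; exact h x)

theorem over_hom_ext {X Y : Over O} {f g : X ⟶ Y} (h : ∀ x : X.left, f.left x = g.left x) :
    f = g := by
  ext x
  exact h x

theorem map_left_map (F : Over O ⥤ Over Q) {X Y Z : Over O} (f : X ⟶ Y) (g : Y ⟶ Z)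
    (x : (F.obj X).left) :
    (F.map g).left ((F.map f).left x) = (F.map (f ≫ g)).left x := by
  rw [F.map_comp]
  rfl

theorem map_left_id (F : Over O ⥤ Over Q) {X : Over O} (x : (F.obj X).left) :
    (F.map (𝟙 X)).left x = x := by
  rw [F.map_id]
  rfl

theorem naturality_left {F G : Over O ⥤ Over Q} (α : F ⟶ G) {X Y : Over O} (f : X ⟶ Y)
    (x : (F.obj X).left) :
    (α.app Y).left ((F.map f).left x) = (G.map f).left ((α.app X).left x) :=
  ConcreteCategory.congr_hom (congrArg CommaMorphism.left (α.naturality f)) x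

theorem iso_hom_inv_left {X Y : Over O} (e : X ≅ Y) (x : X.left) :
    e.inv.left (e.hom.left x) = x :=
  ConcreteCategory.congr_hom (congrArg CommaMorphism.left e.hom_inv_id) x

theorem iso_inv_hom_left {X Y : Over O} (e : X ≅ Y) (y : Y.left) :
    e.hom.left (e.inv.left y) = y := iso_hom_inv_left e.symm y

theorem isIso_of_bijective {X Y : Over O} (f : X ⟶ Y) (h : Function.Bijective f.left) :
    IsIso f := by
  have : IsIso ((Over.forget O).map f) := (isIso_iff_bijective f.left).2 h
  exact isIso_of_reflects_iso f (Over.forget O)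

/-- The one-element object over `o`. -/
def point (o : O) : Over O := Over.mk (Y := PUnit) (↾fun _ => o)

/-! ### Weak limits in slices, elementwise -/

/-- A square in a slice is a weak pullback if and only if every compatible pair of elements comes from
an element of the corner. -/
theorem nonempty_isWeakLimit_pullback_iff {W X Y Z : Over O} {f : X ⟶ Z} {g : Y ⟶ Z} {h : W ⟶ X}
    {k : W ⟶ Y} (e : h ≫ f = k ≫ g) :
    Nonempty (IsWeakLimit (PullbackCone.mk h k e)) ↔
      ∀ (a : X.left) (b : Y.left), f.left a = g.left b →
        ∃ x : W.left, h.left x = a ∧ k.left x = b := by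
  constructor
  · rintro ⟨H⟩ a b hab
    let p : point (X.hom a) ⟶ X := ofFun (fun _ => a) (fun _ => rfl)
    let q : point (X.hom a) ⟶ Y := ofFun (fun _ => b) (fun _ => by
      change Y.hom b = X.hom a
      rw [← hom_left_apply f, hab, hom_left_apply g])
    have w : p ≫ f = q ≫ g := over_hom_ext fun _ => hab
    refine ⟨(PullbackCone.IsWeakLimit.lift H p q w).left PUnit.unit, ?_, ?_⟩
    · exact ConcreteCategory.congr_hom
        (congrArg CommaMorphism.left (PullbackCone.IsWeakLimit.lift_fst H p q w)) PUnit.unit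
    · exact ConcreteCategory.congr_hom
        (congrArg CommaMorphism.left (PullbackCone.IsWeakLimit.lift_snd H p q w)) PUnit.unit
  · intro H
    have key : ∀ s : PullbackCone f g, ∃ l : s.pt ⟶ W, l ≫ h = s.fst ∧ l ≫ k = s.snd := by
      intro s
      have hs (x : s.pt.left) : f.left (s.fst.left x) = g.left (s.snd.left x) :=
        ConcreteCategory.congr_hom (congrArg CommaMorphism.left s.condition) x
      choose l hl using fun x => H _ _ (hs x)
      refine ⟨ofFun l fun x => ?_, over_hom_ext fun x => (hl x).1, over_hom_ext fun x => (hl x).2⟩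
      rw [← hom_left_apply h, (hl x).1, hom_left_apply]
    choose l hl using key
    exact ⟨PullbackCone.IsWeakLimit.mk e l (fun s => (hl s).1) (fun s => (hl s).2)⟩

theorem weaklyCartesian_iff {F G : Over O ⥤ Over Q} (α : F ⟶ G) :
    WeaklyCartesian α ↔ ∀ ⦃X Y : Over O⦄ (f : X ⟶ Y) (a : (F.obj Y).left) (b : (G.obj X).left),
      (α.app Y).left a = (G.map f).left b →
        ∃ x : (F.obj X).left, (F.map f).left x = a ∧ (α.app X).left x = b := by
  simp only [WeaklyCartesian, nonempty_isWeakLimit_pullback_iff]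

/-- A family of elements of the objects of a wide cospan with a common image. -/
structure CompatibleFamily {J : Type*} (K : WidePullbackShape J ⥤ Over O) where
  elt : ∀ j, (K.obj j).left
  map_elt : ∀ j : J, (K.map (WidePullbackShape.Hom.term j)).left (elt (some j)) = elt none

/-- A cone over a wide cospan in a slice is a weak limit if and only if every compatible family of
elements comes from an element of its apex. The index set may be empty: the element at the base of the
cospan always determines the type over which the family lies. -/
theorem nonempty_isWeakLimit_wide_iff {J : Type*} {K : WidePullbackShape J ⥤ Over O} (c : Cone K) :
    Nonempty (IsWeakLimit c) ↔
      ∀ s : CompatibleFamily K, ∃ x : c.pt.left, ∀ j, (c.π.app j).left x = s.elt j := by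
  constructor
  · rintro ⟨H⟩ s
    let o : O := (K.obj none).hom (s.elt none)
    have ho : ∀ j, (K.obj j).hom (s.elt j) = o := by
      rintro (_ | j)
      · rfl
      · change _ = (K.obj none).hom (s.elt none)
        rw [← s.map_elt j, hom_left_apply]
    let t : Cone K := WidePullbackShape.mkCone (X := point o)
      (ofFun (fun _ => s.elt none) (fun _ => ho _))
      (fun j => ofFun (fun _ => s.elt (some j)) (fun _ => ho _))
      (fun j => over_hom_ext fun _ => s.map_elt j)
    refine ⟨(H.lift t).left PUnit.unit, ?_⟩
    intro j
    refine (ConcreteCategory.congr_hom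
      (congrArg CommaMorphism.left (H.fac t j)) PUnit.unit).trans ?_
    cases j <;> rfl
  · intro H
    have key : ∀ t : Cone K, ∃ l : t.pt ⟶ c.pt, ∀ j, l ≫ c.π.app j = t.π.app j := by
      intro t
      have ht (x : t.pt.left) := H ⟨fun j => (t.π.app j).left x, fun j =>
        ConcreteCategory.congr_hom (congrArg CommaMorphism.left
          (t.w (WidePullbackShape.Hom.term j))) x⟩
      choose l hl using ht
      refine ⟨ofFun l fun x => ?_, fun j => over_hom_ext fun x => hl x j⟩
      refine (hom_left_apply (c.π.app none) (l x)).symm.trans ?_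
      rw [hl x none]
      exact hom_left_apply (t.π.app none) x
    choose l hl using key
    exact ⟨⟨l, hl⟩⟩

/-- If elements `z j` of `F (Z j)` have a common image in `F X`, they come from one element of `F` at an
object over all `Z j`, namely at their wide pullback over `X`. -/
theorem WeaklyPreservesWidePullbacks.exists_lift {F : Over O ⥤ Over Q}
    (hF : WeaklyPreservesWidePullbacks F) {J : Type u} {X : Over O} {Z : J → Over O}
    (f : ∀ j, Z j ⟶ X) (w : (F.obj X).left) (z : ∀ j, (F.obj (Z j)).left)
    (h : ∀ j, (F.map (f j)).left (z j) = w) :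
    ∃ (Y : Over O) (q : Y ⟶ X) (p : ∀ j, Y ⟶ Z j) (y : (F.obj Y).left),
      (∀ j, p j ≫ f j = q) ∧ (F.map q).left y = w ∧ ∀ j, (F.map (p j)).left y = z j := by
  let K := WidePullbackShape.wideCospan X Z f
  obtain ⟨y, hy⟩ := (nonempty_isWeakLimit_wide_iff _).1 (hF J K _ (limit.isLimit K))
    ⟨fun j => match j with
      | none => w
      | some j => z j, h⟩
  exact ⟨limit K, limit.π K none, fun j => limit.π K (some j), y,
    fun j => limit.w K (WidePullbackShape.Hom.term j), hy none, fun j => hy (some j)⟩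

theorem WeaklyPreservesWidePullbacks.exists_pullback {F : Over O ⥤ Over Q}
    (hF : WeaklyPreservesWidePullbacks F) {X Z₁ Z₂ : Over O} (f₁ : Z₁ ⟶ X) (f₂ : Z₂ ⟶ X)
    (z₁ : (F.obj Z₁).left) (z₂ : (F.obj Z₂).left) (h : (F.map f₁).left z₁ = (F.map f₂).left z₂) :
    ∃ (Y : Over O) (p₁ : Y ⟶ Z₁) (p₂ : Y ⟶ Z₂) (y : (F.obj Y).left),
      p₁ ≫ f₁ = p₂ ≫ f₂ ∧ (F.map p₁).left y = z₁ ∧ (F.map p₂).left y = z₂ := by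
  obtain ⟨Y, q, p, y, hp, -, hy⟩ := hF.exists_lift (J := ULift Bool)
    (Z := fun j => bif j.down then Z₁ else Z₂)
    (fun j => match j with
      | ⟨true⟩ => f₁
      | ⟨false⟩ => f₂) ((F.map f₁).left z₁)
    (fun j => match j with
      | ⟨true⟩ => z₁
      | ⟨false⟩ => z₂) (by
        rintro ⟨_ | _⟩
        · exact h.symm
        · rfl)
  exact ⟨Y, p ⟨true⟩, p ⟨false⟩, y, (hp ⟨true⟩).trans (hp ⟨false⟩).symm, hy ⟨true⟩, hy ⟨false⟩⟩

/-- A functor that weakly preserves wide pullbacks sends weak pullback squares to such. -/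
theorem WeaklyPreservesWidePullbacks.map_weakPullback {F : Over O ⥤ Over Q}
    (hF : WeaklyPreservesWidePullbacks F) {W X Y Z : Over O} {f : X ⟶ Z} {g : Y ⟶ Z} {h : W ⟶ X}
    {k : W ⟶ Y} {e : h ≫ f = k ≫ g}
    (H : Nonempty (IsWeakLimit (PullbackCone.mk h k e)))
    (a : (F.obj X).left) (b : (F.obj Y).left) (hab : (F.map f).left a = (F.map g).left b) :
    ∃ x : (F.obj W).left, (F.map h).left x = a ∧ (F.map k).left x = b := by
  obtain ⟨V, p, q, y, hpq, rfl, rfl⟩ := hF.exists_pullback f g a b hab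
  obtain ⟨H⟩ := H
  obtain ⟨l, rfl, rfl⟩ : ∃ l : V ⟶ W, l ≫ h = p ∧ l ≫ k = q :=
    ⟨PullbackCone.IsWeakLimit.lift H p q hpq, PullbackCone.IsWeakLimit.lift_fst H p q hpq,
      PullbackCone.IsWeakLimit.lift_snd H p q hpq⟩
  exact ⟨(F.map l).left y, map_left_map F l h y, map_left_map F l k y⟩

/-- The cone in the middle is only a weak limit, so that the composite is not formed cone by cone: a
family for `F ⋙ G` is first lifted along `G` to an object over the diagram, which then maps to the
weak limit. -/
theorem WeaklyPreservesWidePullbacks.comp {F : Over O ⥤ Over Q} {G : Over Q ⥤ Over T}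
    (hF : WeaklyPreservesWidePullbacks F) (hG : WeaklyPreservesWidePullbacks G) :
    WeaklyPreservesWidePullbacks (F ⋙ G) := by
  intro J K c hc
  rw [nonempty_isWeakLimit_wide_iff]
  intro s
  obtain ⟨Y, q, p, y, hp, hq, hy⟩ := hG.exists_lift
    (fun j => F.map (K.map (WidePullbackShape.Hom.term j))) (s.elt none)
    (fun j => s.elt (some j)) s.map_elt
  obtain ⟨H⟩ := hF J K c hc
  let t : Cone (K ⋙ F) := WidePullbackShape.mkCone q p hp
  refine ⟨(G.map (H.lift t)).left y, fun j => ?_⟩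
  refine (map_left_map G (H.lift t) ((F.mapCone c).π.app j) y).trans ?_
  rw [H.fac t j]
  cases j
  · exact hq
  · exact hy _

theorem WeaklyPreservesWidePullbacks.of_iso {F G : Over O ⥤ Over Q} (e : F ≅ G)
    (hF : WeaklyPreservesWidePullbacks F) : WeaklyPreservesWidePullbacks G := by
  intro J K c hc
  rw [nonempty_isWeakLimit_wide_iff]
  intro s
  obtain ⟨x, hx⟩ := (nonempty_isWeakLimit_wide_iff _).1 (hF J K c hc)
    ⟨fun j => (e.inv.app _).left (s.elt j), fun j => by
      rw [← s.map_elt]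
      exact (naturality_left e.inv _ _).symm⟩
  refine ⟨(e.hom.app _).left x, fun j => ?_⟩
  refine (naturality_left e.hom (c.π.app j) x).symm.trans ?_
  refine (congrArg (e.hom.app _).left (hx j)).trans ?_
  exact iso_inv_hom_left (e.app (K.obj j)) _

theorem WeaklyPreservesWidePullbacks.of_preservesLimits {F : Over O ⥤ Over Q}
    (hF : ∀ J : Type u, PreservesLimitsOfShape (WidePullbackShape J) F) :
    WeaklyPreservesWidePullbacks F := fun J _ _ hc =>
  have := hF J
  ⟨(isLimitOfPreserves F hc).isWeakLimit⟩

theorem weaklyPreservesWidePullbacks_reindex (v : O ⟶ Q) :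
    WeaklyPreservesWidePullbacks (reindex v) :=
  .of_preservesLimits fun _ =>
    (reindexAdj v).rightAdjoint_preservesLimits.preservesLimitsOfShape

theorem weaklyPreservesWidePullbacks_map (v : O ⟶ Q) :
    WeaklyPreservesWidePullbacks (Over.map v) := by
  intro J K c hc
  rw [nonempty_isWeakLimit_wide_iff]
  intro s
  exact (nonempty_isWeakLimit_wide_iff c).1 ⟨hc.isWeakLimit⟩ ⟨s.elt, s.map_elt⟩

/-! ### Filtered colimits in slices, elementwise -/

/-- A functor between slices preserves filtered colimits if on underlying sets it satisfies the usual
elementwise description of filtered colimits. -/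
theorem preservesFilteredColimits_of_elementwise {F : Over O ⥤ Over Q}
    (h : ∀ (J : Type u) [Category.{u} J] [IsFiltered J] (K : J ⥤ Over O) (c : Cocone K)
      (_ : IsColimit c),
      (∀ x : (F.obj c.pt).left, ∃ j y, (F.map (c.ι.app j)).left y = x) ∧
      ∀ i (x y : (F.obj (K.obj i)).left),
        (F.map (c.ι.app i)).left x = (F.map (c.ι.app i)).left y →
          ∃ k, ∃ f : i ⟶ k, (F.map (K.map f)).left x = (F.map (K.map f)).left y) :
    PreservesFilteredColimitsOfSize.{u, u} F where
  preserves_filtered_colimits J _ _ :=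
    { preservesColimit := fun {K} =>
        { preserves := fun {c} hc => by
            obtain ⟨h1, h2⟩ := h J K c hc
            refine ⟨isColimitOfReflects (Over.forget Q) ?_⟩
            refine Types.FilteredColimit.isColimitOf' _ _ ?_ ?_
            · intro x
              obtain ⟨j, y, hy⟩ := h1 x
              exact ⟨j, y, hy.symm⟩
            · intro i x y hxy
              exact h2 i x y hxy } }

theorem exists_of_preservesFilteredColimits {F : Over O ⥤ Over Q}
    (hF : PreservesFilteredColimitsOfSize.{u, u} F) {J : Type u} [Category.{u} J] [IsFiltered J]
    {K : J ⥤ Over O} {c : Cocone K} (hc : IsColimit c) (x : (F.obj c.pt).left) :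
    ∃ j y, (F.map (c.ι.app j)).left y = x := by
  have := hF.preserves_filtered_colimits J
  exact Types.jointly_surjective_of_isColimit
    (isColimitOfPreserves (Over.forget Q) (isColimitOfPreserves F hc)) x

theorem exists_map_eq_of_isColimit {J : Type u} [Category.{u} J] [IsFiltered J]
    {K : J ⥤ Over O} {c : Cocone K} (hc : IsColimit c) {i : J} {x y : (K.obj i).left}
    (h : (c.ι.app i).left x = (c.ι.app i).left y) :
    ∃ k, ∃ f : i ⟶ k, (K.map f).left x = (K.map f).left y :=
  (Types.FilteredColimit.isColimit_eq_iff' (isColimitOfPreserves (Over.forget O) hc) x y).1 h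

theorem exists_of_isColimit {J : Type u} [Category.{u} J]
    {K : J ⥤ Over O} {c : Cocone K} (hc : IsColimit c) (x : c.pt.left) :
    ∃ j y, (c.ι.app j).left y = x :=
  Types.jointly_surjective_of_isColimit (isColimitOfPreserves (Over.forget O) hc) x

theorem preservesFilteredColimits_reindex (v : O ⟶ Q) :
    PreservesFilteredColimitsOfSize.{u, u} (reindex v) := by
  refine preservesFilteredColimits_of_elementwise fun J _ _ K c hc => ⟨?_, ?_⟩
  · rintro ⟨⟨o, x⟩, h⟩
    obtain ⟨j, y, rfl⟩ := exists_of_isColimit hc x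
    exact ⟨j, ⟨(o, y), h.trans (hom_left_apply _ _)⟩, rfl⟩
  · rintro i ⟨⟨o, x⟩, h⟩ ⟨⟨o', x'⟩, h'⟩ e
    have e' := Prod.mk.inj (Subtype.mk.inj e)
    obtain ⟨k, f, hf⟩ := exists_map_eq_of_isColimit hc e'.2
    exact ⟨k, f, Subtype.ext (Prod.ext e'.1 hf)⟩

end Elements

/-! ### The functor `A ⋆ (-)` is finitary and weakly preserves wide pullbacks -/

namespace SymSig

variable {O Q : Type u}

theorem Star.exists_mk {A : SymSig O} {X : Over O} (s : Star A X) :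
    ∃ (n : ℕ) (a : A.op n) (x : Fin n → X.left) (h : A.inp a = X.hom ∘ x), s = Star.mk a x h := by
  obtain ⟨n, s⟩ := s
  induction s using Quotient.inductionOn with
  | h p => exact ⟨n, p.1.1, p.1.2, p.2, rfl⟩

theorem Star.mk_eq_mk_iff {A : SymSig O} {X : Over O} {n : ℕ} {a b : A.op n}
    {x y : Fin n → X.left} {h : A.inp a = X.hom ∘ x} {h' : A.inp b = X.hom ∘ y} :
    Star.mk a x h = Star.mk b y h' ↔ ∃ σ : Equiv.Perm (Fin n), b = A.act a σ ∧ y = x ∘ σ := by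
  constructor
  · intro e
    obtain ⟨σ, hσ⟩ := Quotient.exact (eq_of_heq (Sigma.mk.inj e).2)
    exact ⟨σ, (Prod.mk.inj hσ).1, (Prod.mk.inj hσ).2⟩
  · rintro ⟨σ, rfl, rfl⟩
    exact congrArg (Sigma.mk n) (Quotient.sound ⟨σ, rfl⟩)

theorem Star.arity_eq {A : SymSig O} {X : Over O} {n m : ℕ} {a : A.op n} {b : A.op m}
    {x : Fin n → X.left} {y : Fin m → X.left} {h : A.inp a = X.hom ∘ x} {h' : A.inp b = X.hom ∘ y}
    (e : Star.mk a x h = Star.mk b y h') : n = m :=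
  congrArg Sigma.fst e

/-- Along a morphism of slices, a representative `(a, x')` of the image of `s` is the image of
a representative of `s` with the same operation. -/
theorem Star.exists_mk_of_map_eq {A : SymSig O} {X Y : Over O} (g : X ⟶ Y) (s : Star A X) {n : ℕ}
    (a : A.op n) (y : Fin n → Y.left) (h : A.inp a = Y.hom ∘ y)
    (e : (A.star.map g).left s = Star.mk a y h) :
    ∃ (x : Fin n → X.left) (h' : A.inp a = X.hom ∘ x), s = Star.mk a x h' ∧ g.left ∘ x = y := by
  obtain ⟨m, b, x, hb, rfl⟩ := s.exists_mk
  obtain rfl : m = n := Star.arity_eq e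
  obtain ⟨σ, rfl, rfl⟩ : ∃ σ : Equiv.Perm (Fin m), a = A.act b σ ∧ y = (g.left ∘ x) ∘ σ :=
    Star.mk_eq_mk_iff.1 e
  refine ⟨x ∘ σ, ?_, Star.mk_eq_mk_iff.2 ⟨σ, rfl, rfl⟩, rfl⟩
  rw [A.inp_act, hb]
  rfl

theorem weaklyPreservesWidePullbacks_star (A : SymSig O) : WeaklyPreservesWidePullbacks A.star := by
  intro J K c hc
  rw [nonempty_isWeakLimit_wide_iff]
  intro s
  obtain ⟨n, a, x, h, hs⟩ := Star.exists_mk (s.elt none)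
  choose y hy hsy hxy using fun j => Star.exists_mk_of_map_eq
    (K.map (WidePullbackShape.Hom.term j)) (s.elt (some j)) a x h ((s.map_elt j).trans hs)
  choose z hz using fun i => (nonempty_isWeakLimit_wide_iff c).1 ⟨hc.isWeakLimit⟩
    ⟨fun j => match j with
      | none => x i
      | some j => y j i, fun j => congrFun (hxy j) i⟩
  refine ⟨Star.mk a z ?_, ?_⟩
  · rw [h]
    funext i
    exact (congrArg (K.obj none).hom (hz i none)).symm.trans (hom_left_apply (c.π.app none) (z i))
  · rintro (_ | j)
    · rw [hs]
      exact Star.mk_eq_mk_iff.2 ⟨1, (A.act_one a).symm, funext fun i => (hz i none).symm⟩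
    · rw [hsy j]
      exact Star.mk_eq_mk_iff.2 ⟨1, (A.act_one a).symm, funext fun i => (hz i (some j)).symm⟩

/-- In a filtered category, finitely many objects map to a common one. -/
theorem exists_common_target {J : Type u} [Category.{u} J] [IsFiltered J] {n : ℕ} (j : Fin n → J) :
    ∃ k, ∀ i, Nonempty (j i ⟶ k) := by
  classical
  obtain ⟨k, hk⟩ := IsFiltered.sup_objs_exists (Finset.univ.image j)
  exact ⟨k, fun i => hk (Finset.mem_image_of_mem j (Finset.mem_univ i))⟩

/-- In a filtered category, finitely many morphisms out of one object are equalized by morphisms to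
a common target. -/
theorem exists_common_morphism {J : Type u} [Category.{u} J] [IsFiltered J] {n : ℕ} {i : J}
    (k : Fin n → J) (f : ∀ m, i ⟶ k m) :
    ∃ (l : J) (g : i ⟶ l), ∀ m, ∃ h : k m ⟶ l, f m ≫ h = g := by
  induction n with
  | zero => exact ⟨i, 𝟙 i, fun m => m.elim0⟩
  | succ n ih =>
    obtain ⟨l, g, hg⟩ := ih (fun m => k m.succ) (fun m => f m.succ)
    obtain ⟨t, p, q, hpq⟩ := IsFiltered.span (f 0) g
    refine ⟨t, g ≫ q, fun m => ?_⟩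
    induction m using Fin.cases with
    | zero => exact ⟨p, hpq⟩
    | succ m =>
      obtain ⟨h, hh⟩ := hg m
      exact ⟨h ≫ q, by rw [← Category.assoc, hh]⟩

theorem preservesFilteredColimits_star (A : SymSig O) :
    PreservesFilteredColimitsOfSize.{u, u} A.star := by
  refine preservesFilteredColimits_of_elementwise fun J _ _ K c hc => ⟨?_, ?_⟩
  · intro s
    obtain ⟨n, a, x, h, rfl⟩ := Star.exists_mk s
    choose j y hy using fun i => exists_of_isColimit hc (x i)
    obtain ⟨k, hk⟩ := exists_common_target j
    have hyk (i : Fin n) : (c.ι.app k).left ((K.map (hk i).some).left (y i)) = x i :=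
      (ConcreteCategory.congr_hom (congrArg Over.Hom.left (c.w (hk i).some)) (y i)).trans (hy i)
    refine ⟨k, Star.mk a (fun i => (K.map (hk i).some).left (y i)) ?_, ?_⟩
    · rw [h]
      funext i
      exact (congrArg c.pt.hom (hyk i)).symm.trans (hom_left_apply (c.ι.app k) _)
    · exact Star.mk_eq_mk_iff.2 ⟨1, (A.act_one a).symm, funext fun i => (hyk i).symm⟩
  · intro i s t e
    obtain ⟨n, a, x, h, rfl⟩ := Star.exists_mk s
    obtain ⟨m, b, y, h', rfl⟩ := Star.exists_mk t
    obtain rfl : n = m := Star.arity_eq e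
    obtain ⟨σ, hb, hσ⟩ := Star.mk_eq_mk_iff.1 e
    choose k f hf using fun i => exists_map_eq_of_isColimit hc (congrFun hσ i)
    obtain ⟨l, g, hg⟩ := exists_common_morphism k f
    refine ⟨l, g, Star.mk_eq_mk_iff.2 ⟨σ, hb, funext fun i => ?_⟩⟩
    obtain ⟨r, rfl⟩ := hg i
    change (K.map (f i ≫ r)).left (y i) = (K.map (f i ≫ r)).left (x (σ i))
    rw [K.map_comp]
    exact congrArg (K.map r).left (hf i)

theorem isFinitaryWeaklyWide_star (A : SymSig O) : IsFinitaryWeaklyWide A.star :=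
  ⟨A.preservesFilteredColimits_star, A.weaklyPreservesWidePullbacks_star⟩

/-! ### Morphisms of signatures are the weakly cartesian transformations -/

theorem weaklyCartesian_starHom {v : O ⟶ Q} {A : SymSig O} {B : SymSig Q} (f : HomOver v A B) :
    WeaklyCartesian (starHom f) := by
  rw [weaklyCartesian_iff]
  rintro X Y g s ⟨⟨o, t⟩, ht⟩ e
  obtain ⟨n, a, x, h, rfl⟩ := Star.exists_mk s
  obtain ⟨rfl, e⟩ := Prod.mk.inj (Subtype.mk.inj e)
  obtain ⟨y, hy, rfl, hxy⟩ := Star.exists_mk_of_map_eq g t (f.toFun a) (fun i => (x i).1.2) _ e.symm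
  refine ⟨Star.mk a (fun i => ⟨((x i).1.1, y i), ?_⟩) h, ?_, rfl⟩
  · rw [(x i).2, ← congrFun hxy i]
    exact hom_left_apply g (y i)
  · exact Star.mk_eq_mk_iff.2 ⟨1, (A.act_one a).symm, funext fun i =>
      Subtype.ext (Prod.ext rfl (congrFun hxy i).symm)⟩

section Representation

variable {v : O ⟶ Q} {A : SymSig O} {B : SymSig Q}

/-- The finite object of `Set/Q` with elements `1, …, n` typed by `t`. -/
def finObj {n : ℕ} (t : Fin n → Q) : Over Q :=
  Over.mk (Y := ULift.{u} (Fin n)) (↾fun i => t i.down)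

/-- The element `[a, (1, …, n)]` of `A ⋆ v^*{1, …, n}`, where `{1, …, n}` is typed by the input types of
`a`. By naturality it determines a transformation out of `A ⋆ v^*(-)` at the operation `a`. -/
def univElt (v : O ⟶ Q) {n : ℕ} (a : A.op n) :
    (A.star.obj ((reindex v).obj (finObj fun i => v (A.inp a i)))).left :=
  Star.mk (X := (reindex v).obj (finObj fun i => v (A.inp a i))) a
    (fun i => ⟨(A.inp a i, ⟨i⟩), rfl⟩) rfl

/-- A weakly cartesian transformation sends the universal element of `a` to an element whose second
component is `[b, (1, …, n)]` for some operation `b`. -/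
theorem exists_op_of_weaklyCartesian {τ : reindex v ⋙ A.star ⟶ B.star ⋙ reindex v}
    (hτ : WeaklyCartesian τ) {n : ℕ} (a : A.op n) :
    ∃ (b : B.op n) (h : B.inp b = fun i => v (A.inp a i)),
      ((τ.app (finObj fun i => v (A.inp a i))).left (univElt v a)).1.2 =
        Star.mk (X := finObj fun i => v (A.inp a i)) b (fun i => ⟨i⟩) h := by
  rw [weaklyCartesian_iff] at hτ
  obtain ⟨⟨⟨o, t⟩, ht⟩, hτa⟩ :
    ∃ p, (τ.app (finObj fun i => v (A.inp a i))).left (univElt v a) = p := ⟨_, rfl⟩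
  obtain ⟨m, b, y, hb, rfl⟩ := Star.exists_mk t
  let g : finObj (B.inp b) ⟶ finObj fun i => v (A.inp a i) :=
    ofFun (fun i => y i.down) fun i => (congrFun hb i.down).symm
  obtain ⟨w, hw, hw'⟩ := hτ g (univElt v a)
    ⟨(o, Star.mk (X := finObj (B.inp b)) b (fun i => ⟨i⟩) rfl), ht⟩ hτa
  obtain ⟨x, hx, rfl, hgx⟩ := Star.exists_mk_of_map_eq ((reindex v).map g) w a _ rfl hw
  -- The second components of `x` form a section `s` of `y`.
  let s : Fin n → Fin m := fun i => (x i).1.2.down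
  have hys (i : Fin n) : y (s i) = ⟨i⟩ := (Prod.mk.inj (Subtype.mk.inj (congrFun hgx i))).2
  let k : (finObj fun i => v (A.inp a i)) ⟶ finObj (B.inp b) :=
    ofFun (fun i => ⟨s i.down⟩) fun i => by
      change B.inp b (s i.down) = v (A.inp a i.down)
      rw [hb, Function.comp_apply, hys]
      rfl
  have hk : (A.star.map ((reindex v).map k)).left (univElt v a) = Star.mk a x hx :=
    Star.mk_eq_mk_iff.2 ⟨1, (A.act_one a).symm, funext fun i =>
      Subtype.ext (Prod.ext (congrFun hx i).symm rfl)⟩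
  -- By naturality `[b, (1, …, m)] = [b, s ∘ y]`, so that `s` and `y` are mutually inverse.
  have e : Star.mk (X := finObj (B.inp b)) b (fun i => ⟨i⟩) rfl =
      (B.star.map k).left (Star.mk b y hb) := by
    have h1 := naturality_left τ k (univElt v a)
    rw [hτa] at h1
    exact (Prod.mk.inj (Subtype.mk.inj
      (hw'.symm.trans ((congrArg (τ.app _).left hk).symm.trans h1)))).2
  obtain ⟨σ, -, hσ⟩ := Star.mk_eq_mk_iff.1 e
  have hsy (i : Fin m) : s (y i).down = σ i := congrArg ULift.down (congrFun hσ i)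
  have hinj : Function.Injective fun i => (y i).down := fun i j hij =>
    σ.injective (by rw [← hsy, ← hsy]; exact congrArg s hij)
  have hbij : Function.Bijective fun i => (y i).down :=
    ⟨hinj, fun i => ⟨s i, congrArg ULift.down (hys i)⟩⟩
  obtain rfl : m = n := by simpa using Fintype.card_of_bijective hbij
  let π : Equiv.Perm (Fin m) := Equiv.ofBijective _ hbij
  have hπ (i : Fin m) : y (π.symm i) = ⟨i⟩ := congrArg ULift.up (π.apply_symm_apply i)
  refine ⟨B.act b π⁻¹, ?_, ?_⟩
  · rw [B.inp_act, hb]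
    funext i
    exact congrArg (finObj fun i => v (A.inp a i)).hom (hπ i)
  · rw [hτa]
    exact Star.mk_eq_mk_iff.2 ⟨π⁻¹, rfl, funext fun i => (hπ i).symm⟩

/-- A weakly cartesian transformation `A ⋆ v^*(-) ⟶ v^*(B ⋆ (-))` comes from a morphism of
signatures. -/
theorem exists_starHom_eq_of_weaklyCartesian {τ : reindex v ⋙ A.star ⟶ B.star ⋙ reindex v}
    (hτ : WeaklyCartesian τ) : ∃ f : HomOver v A B, starHom f = τ := by
  choose f hinp hf using fun (n : ℕ) (a : A.op n) => exists_op_of_weaklyCartesian hτ a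
  have hout {n : ℕ} (a : A.op n) :
      ((τ.app (finObj fun i => v (A.inp a i))).left (univElt v a)).1.1 = A.out a :=
    hom_left_apply (τ.app _) (univElt v a)
  refine ⟨⟨fun {n} a => f n a, ?_, ?_, fun a => hinp _ a⟩, ?_⟩
  · intro n a σ
    let k : (finObj fun i => v (A.inp (A.act a σ) i)) ⟶ finObj fun i => v (A.inp a i) :=
      ofFun (fun i => ⟨σ i.down⟩) fun i => by
        change v (A.inp a (σ i.down)) = v (A.inp (A.act a σ) i.down)
        rw [A.inp_act]
        rfl
    have hk : (A.star.map ((reindex v).map k)).left (univElt v (A.act a σ)) = univElt v a :=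
      (Star.mk_eq_mk_iff.2 ⟨σ, rfl, funext fun i => by
        refine Subtype.ext (Prod.ext ?_ ?_)
        · exact congrFun (A.inp_act a σ) i
        · rfl⟩).symm
    have e := naturality_left τ k (univElt v (A.act a σ))
    have e' := congrArg (fun p => p.1.2) ((congrArg (τ.app _).left hk).symm.trans e)
    rw [hf] at e'
    obtain ⟨ρ, h1, h2⟩ := Star.mk_eq_mk_iff.1
      (e'.trans (congrArg (B.star.map k).left (hf n (A.act a σ))))
    have : σ = ρ := Equiv.ext fun i => congrArg ULift.down (congrFun h2 i)
    exact h1.trans (by rw [this])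
  · intro n a
    have h := ((τ.app (finObj fun i => v (A.inp a i))).left (univElt v a)).2
    rw [hout] at h
    rw [h, hf]
    rfl
  · ext1
    ext1 Y
    refine over_hom_ext fun s => ?_
    obtain ⟨n, a, x, h, rfl⟩ := Star.exists_mk s
    let g : (finObj fun i => v (A.inp a i)) ⟶ Y :=
      ofFun (fun i => (x i.down).1.2) fun i => by
        rw [← (x i.down).2]
        exact congrArg v (congrFun h i.down).symm
    have hg : (A.star.map ((reindex v).map g)).left (univElt v a) = Star.mk a x h :=
      Star.mk_eq_mk_iff.2 ⟨1, (A.act_one a).symm, funext fun i =>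
        Subtype.ext (Prod.ext (congrFun h i).symm rfl)⟩
    refine Eq.trans ?_ (congrArg (τ.app Y).left hg)
    refine Eq.trans ?_ (naturality_left τ g (univElt v a)).symm
    refine Subtype.ext (Prod.ext (hout a).symm ?_)
    exact (congrArg (B.star.map g).left (hf n a)).symm

end Representation

end SymSig

/-! ### Generic elements -/

section Generic

variable {O : Type u} {F : Over O ⥤ Over O}

/-- An element `y` of `F Y` is generic if, in the category of elements of `F`, every morphism into
`(Y, y)` has a section. -/
def IsGeneric (F : Over O ⥤ Over O) {Y : Over O} (y : (F.obj Y).left) : Prop :=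
  ∀ ⦃Z : Over O⦄ (z : (F.obj Z).left) (f : Z ⟶ Y), (F.map f).left z = y →
    ∃ s : Y ⟶ Z, s ≫ f = 𝟙 Y ∧ (F.map s).left y = z

theorem IsGeneric.map_iso {Y Y' : Over O} {y : (F.obj Y).left} (hy : IsGeneric F y) (e : Y ≅ Y') :
    IsGeneric F ((F.map e.hom).left y) := by
  intro Z z f hz
  obtain ⟨s, hs, rfl⟩ := hy z (f ≫ e.inv) (by
    rw [← map_left_map, hz, map_left_map, e.hom_inv_id, map_left_id])
  refine ⟨e.inv ≫ s, ?_, ?_⟩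
  · rw [Category.assoc, ← cancel_mono e.inv, Category.assoc, Category.assoc, hs, Category.comp_id,
      Category.id_comp]
  · rw [map_left_map, e.hom_inv_id_assoc]

/-- Two generic elements with the same image are isomorphic over that image. -/
theorem IsGeneric.exists_iso (hF : WeaklyPreservesWidePullbacks F) {X Y Y' : Over O}
    {y : (F.obj Y).left} {y' : (F.obj Y').left} (hy : IsGeneric F y) (hy' : IsGeneric F y')
    (g : Y ⟶ X) (g' : Y' ⟶ X) (h : (F.map g).left y = (F.map g').left y') :
    ∃ e : Y ≅ Y', e.hom ≫ g' = g ∧ (F.map e.hom).left y = y' := by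
  obtain ⟨P, p, p', x, hp, hx, hx'⟩ := hF.exists_pullback g g' y y' h
  obtain ⟨s, hs, hsx⟩ := hy x p hx
  have hk : (F.map (s ≫ p')).left y = y' := by rw [← map_left_map, hsx, hx']
  obtain ⟨r, hr, hry⟩ := hy' y (s ≫ p') hk
  obtain ⟨q, hq, -⟩ := hy y' r hry
  -- `r` is a split monomorphism and a split epimorphism.
  have hqk : q = s ≫ p' := by
    have := congrArg (q ≫ ·) hr
    simp only [reassoc_of% hq, Category.comp_id] at this
    exact this.symm
  refine ⟨⟨s ≫ p', r, hqk ▸ hq, hr⟩, ?_, hk⟩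
  rw [Category.assoc, ← hp, reassoc_of% hs]

/-- A finite object of a slice is isomorphic to one on `{1, …, n}`. -/
theorem exists_finObj_iso (S : Over O) [Finite S.left] :
    ∃ t : Fin (Nat.card S.left) → O, Nonempty (SymSig.finObj t ≅ S) := by
  let e := Finite.equivFin S.left
  refine ⟨fun i => S.hom (e.symm i), ⟨Over.isoMk (Equiv.ulift.trans e.symm).toIso ?_⟩⟩
  ext
  rfl

/-- The finite subobjects of `X`, as a filtered diagram. -/
def finiteSubobjects (X : Over O) : Finset X.left ⥤ Over O where
  obj S := Over.mk (Y := { x // x ∈ S }) (↾fun x => X.hom x.1)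
  map f := ofFun (fun x => ⟨x.1, leOfHom f x.2⟩) fun _ => rfl

/-- The inclusion of a finite subobject of `X`. -/
def finiteSubobjectsι (X : Over O) (S : Finset X.left) : (finiteSubobjects X).obj S ⟶ X :=
  ofFun (fun x => x.1) fun _ => rfl

/-- The cocone on the finite subobjects of `X` given by their inclusions. -/
def finiteSubobjectsCocone (X : Over O) : Cocone (finiteSubobjects X) where
  pt := X
  ι := { app := finiteSubobjectsι X }

open scoped Classical in
/-- Every object of a slice is the filtered colimit of its finite subobjects. -/
noncomputable def isColimitFiniteSubobjectsCocone (X : Over O) :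
    IsColimit (finiteSubobjectsCocone X) :=
  isColimitOfReflects (Over.forget O) <| Types.FilteredColimit.isColimitOf' _ _
    (fun x => ⟨{x}, ⟨x, Finset.mem_singleton_self x⟩, rfl⟩)
    (fun i _ _ h => ⟨i, 𝟙 i, congrArg _ (Subtype.ext h)⟩)

/-- The elements of a finitary functor have finite support. -/
theorem exists_finite_support (hF : PreservesFilteredColimitsOfSize.{u, u} F) {X : Over O}
    (x : (F.obj X).left) :
    ∃ (n : ℕ) (t : Fin n → O) (y : (F.obj (SymSig.finObj t)).left) (g : SymSig.finObj t ⟶ X),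
      (F.map g).left y = x := by
  classical
  obtain ⟨S, y, rfl⟩ : ∃ S y, (F.map (finiteSubobjectsι X S)).left y = x :=
    exists_of_preservesFilteredColimits hF (isColimitFiniteSubobjectsCocone X) x
  have : Finite ((finiteSubobjects X).obj S).left := inferInstanceAs (Finite { x // x ∈ S })
  obtain ⟨t, ⟨e⟩⟩ := exists_finObj_iso ((finiteSubobjects X).obj S)
  refine ⟨_, t, (F.map e.inv).left y, e.hom ≫ finiteSubobjectsι X S, ?_⟩
  rw [map_left_map, e.inv_hom_id_assoc]

/-- A finite support of an element `x` of `F X`: an element of `F` at a finite object, with a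
morphism to `X` that sends it to `x`. -/
structure FiniteSupport (F : Over O ⥤ Over O) {X : Over O} (x : (F.obj X).left) : Type u where
  card : ℕ
  type : Fin card → O
  elt : (F.obj (SymSig.finObj type)).left
  map : SymSig.finObj type ⟶ X
  map_elt : (F.map map).left elt = x

/-- A finite support of `x` is weakly initial if it maps to every finite support of `x`. -/
def FiniteSupport.IsWeaklyInitial {X : Over O} {x : (F.obj X).left} (s : FiniteSupport F x) : Prop :=
  ∀ s' : FiniteSupport F x, ∃ k : SymSig.finObj s.type ⟶ SymSig.finObj s'.type,
    k ≫ s'.map = s.map ∧ (F.map k).left s.elt = s'.elt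

/-- A finite support of the compatible family of all finite supports, at their wide pullback,
is weakly initial. -/
theorem exists_isWeaklyInitial (hF : IsFinitaryWeaklyWide F) {X : Over O} (x : (F.obj X).left) :
    ∃ s : FiniteSupport F x, s.IsWeaklyInitial := by
  obtain ⟨L, q, p, l, hp, hq, hl⟩ := hF.wide.exists_lift (J := FiniteSupport F x)
    (fun s => s.map) x (fun s => s.elt) (fun s => s.map_elt)
  obtain ⟨n, t, y, g, rfl⟩ := exists_finite_support hF.finitary l
  refine ⟨⟨n, t, y, g ≫ q, by rw [← map_left_map, hq]⟩, fun s' => ⟨g ≫ p s', ?_, ?_⟩⟩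
  · rw [Category.assoc, hp]
  · exact (map_left_map F g (p s') y).symm.trans (hl s')

/-- An endomorphism of a weakly initial finite support of least cardinality is bijective, since its
image is again a weakly initial finite support. -/
theorem FiniteSupport.isIso_of_minimal {X : Over O} {x : (F.obj X).left} (s : FiniteSupport F x)
    (hs : s.IsWeaklyInitial)
    (hmin : ∀ s' : FiniteSupport F x, s'.IsWeaklyInitial → s.card ≤ s'.card)
    (c : SymSig.finObj s.type ⟶ SymSig.finObj s.type) (hc : c ≫ s.map = s.map)
    (hce : (F.map c).left s.elt = s.elt) : IsIso c := by
  have hfin : Finite (SymSig.finObj s.type).left := inferInstanceAs (Finite (ULift (Fin s.card)))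
  refine isIso_of_bijective c (Finite.injective_iff_bijective.1
    (Finite.injective_iff_surjective.2 ?_))
  let I : Over O := Over.mk (Y := Set.range c.left) (↾fun i => (SymSig.finObj s.type).hom i.1)
  let p : SymSig.finObj s.type ⟶ I :=
    ofFun (fun i => ⟨c.left i, i, rfl⟩) fun i => hom_left_apply c i
  let j : I ⟶ SymSig.finObj s.type := ofFun (fun i => i.1) fun _ => rfl
  have hpj : p ≫ j = c := over_hom_ext fun _ => rfl
  have : Finite I.left := inferInstanceAs (Finite (Set.range c.left))
  obtain ⟨t, ⟨e⟩⟩ := exists_finObj_iso I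
  let s' : FiniteSupport F x := ⟨_, t, (F.map (p ≫ e.inv)).left s.elt, e.hom ≫ j ≫ s.map, by
    rw [map_left_map, Category.assoc, e.inv_hom_id_assoc, reassoc_of% hpj, hc, s.map_elt]⟩
  have hs' : s'.IsWeaklyInitial := by
    intro s''
    obtain ⟨k, hk, hke⟩ := hs s''
    refine ⟨e.hom ≫ j ≫ k, ?_, ?_⟩
    · rw [Category.assoc, Category.assoc, hk]
    · change (F.map (e.hom ≫ j ≫ k)).left ((F.map (p ≫ e.inv)).left s.elt) = _
      rw [map_left_map, Category.assoc, e.inv_hom_id_assoc, reassoc_of% hpj, ← map_left_map, hce,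
        hke]
  have hle : Nat.card (SymSig.finObj s.type).left ≤ Nat.card (Set.range c.left) := by
    refine le_trans (le_of_eq ?_) (hmin s' hs')
    exact (Nat.card_congr Equiv.ulift).trans (Nat.card_fin _)
  rw [← Set.range_eq_univ]
  rw [← Set.ncard_univ] at hle
  exact Set.eq_of_subset_of_ncard_le (Set.subset_univ _) hle

/-- Every element of a finitary functor that weakly preserves wide pullbacks is the image of a
generic element at a finite object. -/
theorem exists_isGeneric (hF : IsFinitaryWeaklyWide F) {X : Over O} (x : (F.obj X).left) :
    ∃ (n : ℕ) (t : Fin n → O) (y : (F.obj (SymSig.finObj t)).left) (g : SymSig.finObj t ⟶ X),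
      IsGeneric F y ∧ (F.map g).left y = x := by
  obtain ⟨s, hs, hmin⟩ : ∃ s : FiniteSupport F x, s.IsWeaklyInitial ∧
      ∀ s' : FiniteSupport F x, s'.IsWeaklyInitial → s.card ≤ s'.card := by
    obtain ⟨s, hs⟩ := exists_isWeaklyInitial hF x
    obtain ⟨s, hs, h⟩ := WellFounded.has_min (measure (FiniteSupport.card (F := F) (x := x))).wf
      {s | s.IsWeaklyInitial} ⟨s, hs⟩
    exact ⟨s, hs, fun s' hs' => not_lt.1 (h s' hs')⟩
  -- Given `(Z, z) ⟶ (Y, y)`, a morphism back exists over `x` by weak initiality, and the resulting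
  -- endomorphism of `(Y, y)` is invertible by minimality.
  refine ⟨s.card, s.type, s.elt, s.map, fun Z z f hz => ?_, s.map_elt⟩
  obtain ⟨n, t, y, h, rfl⟩ := exists_finite_support hF.finitary z
  rw [map_left_map] at hz
  obtain ⟨k, hk, hky⟩ : ∃ k : SymSig.finObj s.type ⟶ SymSig.finObj t,
      k ≫ h ≫ f ≫ s.map = s.map ∧ (F.map k).left s.elt = y :=
    hs ⟨n, t, y, h ≫ f ≫ s.map, by
      rw [← Category.assoc, ← map_left_map, hz, s.map_elt]⟩
  have hc : (F.map (k ≫ h ≫ f)).left s.elt = s.elt := by rw [← map_left_map, hky, hz]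
  have := s.isIso_of_minimal hs hmin (k ≫ h ≫ f) (by simpa using hk) hc
  refine ⟨inv (k ≫ h ≫ f) ≫ k ≫ h, ?_, ?_⟩
  · simp
  · have := congrArg (F.map (inv (k ≫ h ≫ f) ≫ k ≫ h)).left hc
    rw [map_left_map, IsIso.hom_inv_id_assoc, ← map_left_map, hky] at this
    exact this.symm

end Generic

/-! ### The signature of generic elements -/

section GenericSignature

variable {O : Type u}

open SymSig (finObj)

/-- The generic elements of `F` at the finite objects `{1, …, n}`, over all typings of `1, …, n`. -/
structure GenericOp (F : Over O ⥤ Over O) (n : ℕ) : Type u where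
  type : Fin n → O
  elt : (F.obj (finObj type)).left
  isGeneric : IsGeneric F elt

/-- Equality of generic operations is tested along a morphism that is the identity on `{1, …, n}`, which
avoids transporting elements along an equality of typings. -/
theorem GenericOp.eq_of_map {F : Over O ⥤ Over O} {n : ℕ} {a b : GenericOp F n}
    (k : finObj a.type ⟶ finObj b.type) (hk : ∀ i, k.left i = i)
    (h : (F.map k).left a.elt = b.elt) : a = b := by
  obtain ⟨t, y, hy⟩ := a
  obtain ⟨t', y', hy'⟩ := b
  obtain rfl : t = t' := funext fun i => by
    exact (hom_left_apply k ⟨i⟩).symm.trans (congrArg (finObj t').hom (hk ⟨i⟩))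
  obtain rfl : k = 𝟙 _ := over_hom_ext hk
  obtain rfl : y = y' := (map_left_id F y).symm.trans h
  rfl

/-- A permutation as an isomorphism of finite objects, `i ↦ σ⁻¹ i`. -/
def permIso {n : ℕ} (t : Fin n → O) (σ : Equiv.Perm (Fin n)) : finObj t ≅ finObj (t ∘ σ) where
  hom := ofFun (fun i => ⟨σ.symm i.down⟩) fun i => congrArg t (σ.apply_symm_apply i.down)
  inv := ofFun (fun i => ⟨σ i.down⟩) fun _ => rfl
  hom_inv_id := over_hom_ext fun i => congrArg ULift.up (σ.apply_symm_apply i.down)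
  inv_hom_id := over_hom_ext fun i => congrArg ULift.up (σ.symm_apply_apply i.down)

/-- The symmetric signature of generic elements of an endofunctor of `Set/O`. -/
def genericSig (F : Over O ⥤ Over O) : SymSig O where
  op := GenericOp F
  act a σ := ⟨a.type ∘ σ, (F.map (permIso a.type σ).hom).left a.elt, a.isGeneric.map_iso _⟩
  act_one a := GenericOp.eq_of_map (permIso a.type 1).inv (fun _ => rfl) (by
    dsimp only
    rw [map_left_map, Iso.hom_inv_id, map_left_id])
  act_mul a σ τ := GenericOp.eq_of_map (𝟙 _) (fun _ => rfl) ((map_left_id F _).trans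
    (map_left_map F (permIso a.type σ).hom (permIso (a.type ∘ σ) τ).hom a.elt).symm)
  out {n} a := (F.obj (finObj a.type)).hom a.elt
  inp a := a.type
  out_act a σ := hom_left_apply (F.map (permIso a.type σ).hom) a.elt
  inp_act a σ := rfl

/-- The morphism out of a finite object given by a tuple of elements. -/
def tuple {X : Over O} {n : ℕ} {t : Fin n → O} (x : Fin n → X.left) (h : t = X.hom ∘ x) :
    finObj t ⟶ X :=
  ofFun (fun i => x i.down) fun i => (congrFun h i.down).symm

/-- The comparison `A ⋆ X → F X`, `[(t, y), x] ↦ F x (y)`, for `A` the signature of generic elements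
of `F`. -/
def genericSigEval (F : Over O ⥤ Over O) {X : Over O} (s : SymSig.Star (genericSig F) X) :
    (F.obj X).left :=
  Quotient.lift (s := SymSig.preSetoid (genericSig F) X s.1)
    (fun p => (F.map (tuple p.1.2 p.2)).left p.1.1.elt) (by
      rintro ⟨⟨a, x⟩, hx⟩ ⟨⟨b, y⟩, hy⟩ ⟨σ, h⟩
      obtain ⟨rfl, rfl⟩ := Prod.mk.inj h
      symm
      refine (map_left_map F (permIso a.type σ).hom (tuple (x ∘ σ) hy) a.elt).trans ?_
      refine congrArg (fun k => (F.map k).left a.elt) (over_hom_ext fun i => ?_)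
      exact congrArg x (σ.apply_symm_apply i.down)) s.2

theorem hom_genericSigEval (F : Over O ⥤ Over O) {X : Over O} (s : SymSig.Star (genericSig F) X) :
    (F.obj X).hom (genericSigEval F s) = SymSig.Star.out s := by
  obtain ⟨n, a, x, h, rfl⟩ := s.exists_mk
  exact hom_left_apply (F.map (tuple x h)) a.elt

/-- The comparison transformation from `A ⋆ (-)`, for `A` the signature of generic elements of `F`,
to `F`. -/
def genericSigHom (F : Over O ⥤ Over O) : (genericSig F).star ⟶ F where
  app X := ofFun (X := (genericSig F).star.obj X) (genericSigEval F) (hom_genericSigEval F)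
  naturality X Y g := by
    refine over_hom_ext fun s => ?_
    obtain ⟨n, a, x, h, rfl⟩ := SymSig.Star.exists_mk s
    exact (map_left_map F (tuple x h) g a.elt).symm

/-- Surjectivity is the existence of generic elements, injectivity their uniqueness up to a bijection
over the common image. -/
theorem genericSigEval_bijective {F : Over O ⥤ Over O} (hF : IsFinitaryWeaklyWide F) (X : Over O) :
    Function.Bijective (genericSigEval F (X := X)) := by
  constructor
  · intro s s' e
    obtain ⟨n, a, x, h, rfl⟩ := s.exists_mk
    obtain ⟨m, b, y, h', rfl⟩ := s'.exists_mk
    obtain ⟨k, hk, hab⟩ := a.isGeneric.exists_iso hF.wide b.isGeneric _ _ e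
    have hbij : Function.Bijective fun i : Fin n => (k.hom.left ⟨i⟩).down :=
      Function.bijective_iff_has_inverse.2 ⟨fun i => (k.inv.left ⟨i⟩).down,
        fun i => congrArg ULift.down (iso_hom_inv_left k ⟨i⟩),
        fun i => congrArg ULift.down (iso_inv_hom_left k ⟨i⟩)⟩
    obtain rfl : n = m := by simpa using Fintype.card_of_bijective hbij
    let σ : Equiv.Perm (Fin n) := Equiv.ofBijective _ hbij
    have hy (i : Fin n) : y (σ i) = x i :=
      ConcreteCategory.congr_hom (congrArg Over.Hom.left hk) ⟨i⟩
    refine SymSig.Star.mk_eq_mk_iff.2 ⟨σ.symm, ?_, funext fun i => ?_⟩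
    · refine (GenericOp.eq_of_map ((permIso a.type σ.symm).inv ≫ k.hom) (fun i => ?_) ?_).symm
      · exact congrArg ULift.up (σ.apply_symm_apply i.down)
      · refine (map_left_map F (permIso a.type σ.symm).hom _ a.elt).trans ?_
        exact (congrArg (fun g => (F.map g).left a.elt) (Iso.hom_inv_id_assoc _ _)).trans hab
    · rw [Function.comp_apply, ← hy, σ.apply_symm_apply]
  · intro x
    obtain ⟨n, t, y, g, hy, rfl⟩ := exists_isGeneric hF x
    have h : t = X.hom ∘ fun i => g.left ⟨i⟩ := funext fun i => (hom_left_apply g ⟨i⟩).symm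
    exact ⟨SymSig.Star.mk (A := genericSig F) ⟨t, y, hy⟩ (fun i => g.left ⟨i⟩) h, rfl⟩

theorem IsFinitaryWeaklyWide.of_iso {F G : Over O ⥤ Over O} (e : F ≅ G)
    (hF : IsFinitaryWeaklyWide F) : IsFinitaryWeaklyWide G where
  finitary :=
    { preserves_filtered_colimits J _ _ :=
        have := hF.finitary.preserves_filtered_colimits J
        preservesColimitsOfShape_of_natIso e }
  wide := hF.wide.of_iso e

theorem isAnalytic_iff (F : Over O ⥤ Over O) : IsAnalytic F ↔ IsFinitaryWeaklyWide F := by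
  constructor
  · rintro ⟨A, ⟨e⟩⟩
    exact A.isFinitaryWeaklyWide_star.of_iso e
  · intro hF
    have (X : Over O) : IsIso ((genericSigHom F).app X) :=
      isIso_of_bijective _ (genericSigEval_bijective hF X)
    have := NatIso.isIso_of_isIso_app (genericSigHom F)
    exact ⟨genericSig F, ⟨asIso (genericSigHom F)⟩⟩

end GenericSignature

/-! ### Closure properties of weakly cartesian transformations -/

section WeaklyCartesian

variable {O Q T : Type u}

theorem WeaklyCartesian.comp {F G H : Over O ⥤ Over Q} {α : F ⟶ G} {β : G ⟶ H}
    (hα : WeaklyCartesian α) (hβ : WeaklyCartesian β) : WeaklyCartesian (α ≫ β) := by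
  rw [weaklyCartesian_iff] at *
  intro X Y f a c h
  obtain ⟨b, hb, rfl⟩ := hβ f ((α.app Y).left a) c h
  obtain ⟨x, rfl, rfl⟩ := hα f a b hb.symm
  exact ⟨x, rfl, rfl⟩

theorem weaklyCartesian_of_bijective {F G : Over O ⥤ Over Q} {α : F ⟶ G}
    (hα : ∀ X, Function.Bijective (α.app X).left) : WeaklyCartesian α := by
  rw [weaklyCartesian_iff]
  intro X Y f a b h
  obtain ⟨x, rfl⟩ := (hα X).2 b
  refine ⟨x, (hα Y).1 ?_, rfl⟩
  rw [naturality_left, h]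

theorem bijective_left {X Y : Over O} (f : X ⟶ Y) [IsIso f] : Function.Bijective f.left :=
  (isIso_iff_bijective _).1 (inferInstanceAs (IsIso ((Over.forget O).map f)))

theorem weaklyCartesian_of_isIso {F G : Over O ⥤ Over Q} (α : F ⟶ G) [IsIso α] :
    WeaklyCartesian α :=
  weaklyCartesian_of_bijective fun _ => bijective_left _

theorem WeaklyCartesian.whiskerLeft {F G : Over Q ⥤ Over T} {α : F ⟶ G}
    (hα : WeaklyCartesian α) (H : Over O ⥤ Over Q) :
    WeaklyCartesian (Functor.whiskerLeft H α) := by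
  intro X Y f
  exact hα (H.map f)

theorem WeaklyCartesian.whiskerRight {F G : Over O ⥤ Over Q} {α : F ⟶ G}
    (hα : WeaklyCartesian α) {H : Over Q ⥤ Over T} (hH : WeaklyPreservesWidePullbacks H) :
    WeaklyCartesian (Functor.whiskerRight α H) := by
  rw [weaklyCartesian_iff]
  intro X Y f a b h
  exact hH.map_weakPullback (hα f) a b h

end WeaklyCartesian

/-! ### Closure properties of analytic endofunctors -/

section Closure

variable {O Q : Type u}

theorem IsFinitaryWeaklyWide.conj {R : Over Q ⥤ Over Q} (hR : IsFinitaryWeaklyWide R)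
    {F : Over O ⥤ Over Q} {G : Over Q ⥤ Over O}
    (hF : PreservesFilteredColimitsOfSize.{u, u} F) (hF' : WeaklyPreservesWidePullbacks F)
    (hG : PreservesFilteredColimitsOfSize.{u, u} G) (hG' : WeaklyPreservesWidePullbacks G) :
    IsFinitaryWeaklyWide (F ⋙ R ⋙ G) where
  finitary :=
    have := hR.finitary
    inferInstance
  wide := hF'.comp (hR.wide.comp hG')

theorem isFinitaryWeaklyWide_id (O : Type u) : IsFinitaryWeaklyWide (𝟭 (Over O)) where
  finitary := inferInstance
  wide := .of_preservesLimits fun _ => inferInstance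

theorem IsFinitaryWeaklyWide.comp {P P' : Over O ⥤ Over O} (hP : IsFinitaryWeaklyWide P)
    (hP' : IsFinitaryWeaklyWide P') : IsFinitaryWeaklyWide (P' ⋙ P) :=
  hP.conj (G := 𝟭 _) hP'.finitary hP'.wide (isFinitaryWeaklyWide_id O).finitary
    (isFinitaryWeaklyWide_id O).wide

end Closure

/-! ### Isomorphisms of the exponential fibration -/

namespace ExpSet

variable {O : Type u}

theorem weaklyCartesian_comp {P R S : ExpSet.{u}} (τ : P ⟶ R) (σ : R ⟶ S)
    (hP : WeaklyPreservesWidePullbacks P.functor) (hτ : WeaklyCartesian (nat τ))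
    (hσ : WeaklyCartesian (nat σ)) : WeaklyCartesian (nat (τ ≫ σ)) := by
  refine WeaklyCartesian.comp ?_ (.comp ?_ (.comp ?_ ?_))
  · exact .whiskerRight (weaklyCartesian_of_isIso (reindexComp _ _).hom) hP
  · exact hτ.whiskerLeft _
  · exact hσ.whiskerRight (weaklyPreservesWidePullbacks_reindex _)
  · exact (weaklyCartesian_of_isIso (reindexComp _ _).inv).whiskerLeft _

theorem bijective_nat_app_of_eq_id {P : ExpSet.{u}} {χ : P ⟶ P} (h : χ = 𝟙 P) (Y : Over P.base) :
    Function.Bijective ((nat χ).app Y).left := by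
  subst h
  have : IsIso ((nat (𝟙 P)).app Y) :=
    inferInstanceAs (IsIso (P.functor.map ((reindexId P.base).hom.app Y) ≫
      (reindexId P.base).inv.app (P.functor.obj Y)))
  exact bijective_left _

/-- For `φ ≫ ψ = 𝟙`, the composite `P v^* w^* Y ⟶ v^* R w^* Y ⟶ v^* w^* P Y` is bijective, as it differs from
the underlying transformation of the identity by canonical isomorphisms. -/
theorem bijective_nat_comp {P R : ExpSet.{u}} {φ : P ⟶ R} {ψ : R ⟶ P} (h : φ ≫ ψ = 𝟙 P)
    (Y : Over P.base) :
    Function.Bijective (((reindex (Hom.base φ)).map ((nat ψ).app Y)).left ∘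
      ((nat φ).app ((reindex (Hom.base ψ)).obj Y)).left) := by
  let c := P.functor.map ((reindexComp (Hom.base φ) (Hom.base ψ)).hom.app Y)
  let c' := (reindexComp (Hom.base φ) (Hom.base ψ)).inv.app (P.functor.obj Y)
  have h1 : Function.Bijective (c'.left ∘ (((reindex (Hom.base φ)).map ((nat ψ).app Y)).left ∘
      ((nat φ).app ((reindex (Hom.base ψ)).obj Y)).left) ∘ c.left) :=
    bijective_nat_app_of_eq_id h Y
  have h2 : Function.Bijective c'.left := bijective_left c'
  have h3 : Function.Bijective c.left := bijective_left c
  exact (Function.Bijective.of_comp_iff _ h3).1 ((Function.Bijective.of_comp_iff' h2 _).1 h1)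

theorem base_leftInverse {P R : ExpSet.{u}} {φ : P ⟶ R} {ψ : R ⟶ P} (h : φ ≫ ψ = 𝟙 P) :
    Function.LeftInverse (Hom.base ψ) (Hom.base φ) := fun o =>
  ConcreteCategory.congr_hom (congrArg Hom.base h) o

theorem surjective_nat_app {P R : ExpSet.{u}} {φ : P ⟶ R} {ψ : R ⟶ P}
    (h : φ ≫ ψ = 𝟙 P) (h' : ψ ≫ φ = 𝟙 R) (Y : Over R.base) :
    Function.Surjective ((nat φ).app Y).left := by
  intro z
  let q := Hom.base φ (((reindex (Hom.base φ)).obj (R.functor.obj Y)).hom z)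
  obtain ⟨p, hp⟩ := (bijective_nat_comp h' Y).2 ⟨(q, z), base_leftInverse h _⟩
  exact ⟨_, congrArg (fun p => p.1.2) hp⟩

/-- The transformations underlying isomorphisms of `Exp(Set)` are pointwise bijective. -/
theorem bijective_nat_app {P R : ExpSet.{u}} (e : P ≅ R) (Y : Over R.base) :
    Function.Bijective ((nat e.hom).app Y).left := by
  refine ⟨fun x x' hx => ?_, surjective_nat_app e.hom_inv_id e.inv_hom_id Y⟩
  have hxx : (P.functor.obj ((reindex (Hom.base e.hom)).obj Y)).hom x =
      (P.functor.obj ((reindex (Hom.base e.hom)).obj Y)).hom x' :=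
    ((hom_left_apply ((nat e.hom).app Y) x).symm.trans (congrArg _ hx)).trans
      (hom_left_apply ((nat e.hom).app Y) x')
  let q := Hom.base e.hom ((P.functor.obj ((reindex (Hom.base e.hom)).obj Y)).hom x)
  have hq := base_leftInverse e.hom_inv_id
    ((P.functor.obj ((reindex (Hom.base e.hom)).obj Y)).hom x)
  have hψ := surjective_nat_app e.inv_hom_id e.hom_inv_id ((reindex (Hom.base e.hom)).obj Y)
  obtain ⟨r, hr⟩ := hψ ⟨(q, x), hq⟩
  obtain ⟨r', hr'⟩ := hψ ⟨(q, x'), hq.trans hxx⟩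
  have : r = r' := (bijective_nat_comp e.inv_hom_id Y).1 (by
    rw [Function.comp_apply, Function.comp_apply, hr, hr']
    exact Subtype.ext (Prod.ext rfl hx))
  rw [this, hr'] at hr
  exact (Prod.mk.inj (Subtype.mk.inj hr)).2.symm

theorem weaklyCartesian_of_iso {P R : ExpSet.{u}} (e : P ≅ R) : WeaklyCartesian (nat e.hom) :=
  weaklyCartesian_of_bijective (bijective_nat_app e)

/-- Being finitary and weakly preserving wide pullbacks is invariant under isomorphism in
`Exp(Set)`: an isomorphism over a bijection `v` exhibits `P` as the conjugate of `R` by `v^*`. -/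
theorem isFinitaryWeaklyWide_of_iso {P R : ExpSet.{u}} (e : P ≅ R)
    (hR : IsFinitaryWeaklyWide R.functor) :
    IsFinitaryWeaklyWide P.functor := by
  have (Y : Over R.base) : IsIso ((nat e.hom).app Y) :=
    isIso_of_bijective _ (bijective_nat_app e Y)
  have := NatIso.isIso_of_isIso_app (nat e.hom)
  have hb : 𝟙 P.base = Hom.base e.hom ≫ Hom.base e.inv := (congrArg Hom.base e.hom_inv_id).symm
  let i : 𝟭 (Over P.base) ≅ reindex (Hom.base e.inv) ⋙ reindex (Hom.base e.hom) :=
    (reindexId P.base).symm ≪≫ eqToIso (congrArg reindex hb) ≪≫ reindexComp _ _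
  let j : reindex (Hom.base e.inv) ⋙ R.functor ⋙ reindex (Hom.base e.hom) ≅ P.functor :=
    Functor.isoWhiskerLeft (reindex (Hom.base e.inv)) (asIso (nat e.hom)).symm ≪≫
      Functor.isoWhiskerRight i.symm P.functor
  exact .of_iso j (hR.conj (preservesFilteredColimits_reindex _)
    (weaklyPreservesWidePullbacks_reindex _) (preservesFilteredColimits_reindex _)
    (weaklyPreservesWidePullbacks_reindex _))

theorem reindex_id_ext {Y : Over O} {p q : ((reindex (𝟙 O)).obj Y).left} (h : p.1.2 = q.1.2) :
    p = q :=
  Subtype.ext (Prod.ext (p.2.trans ((congrArg Y.hom h).trans q.2.symm)) h)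

/-- A natural transformation as a morphism of the fibre of `Exp(Set)` over `O`. -/
def fiberHom {F G : Over O ⥤ Over O} (α : F ⟶ G) : (⟨O, F⟩ : ExpSet.{u}) ⟶ ⟨O, G⟩ :=
  homMk (𝟙 O) (Functor.whiskerRight (reindexId O).hom F ≫ α ≫
    Functor.whiskerLeft G (reindexId O).inv)

theorem fiberHom_id (F : Over O ⥤ Over O) : fiberHom (𝟙 F) = 𝟙 (⟨O, F⟩ : ExpSet.{u}) :=
  congrArg (homMk (P := F) (R := F) (𝟙 O)) (by
    ext1
    ext1 Y
    change F.map _ ≫ 𝟙 _ ≫ _ = F.map _ ≫ _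
    rw [Category.id_comp])

theorem fiberHom_comp {F G H : Over O ⥤ Over O} (α : F ⟶ G) (β : G ⟶ H) :
    fiberHom α ≫ fiberHom β = fiberHom (α ≫ β) := by
  refine congrArg (homMk (P := F) (R := H) (𝟙 O)) ?_
  ext1
  ext1 Y
  refine over_hom_ext fun x => ?_
  have hid : F.map ((reindexComp (𝟙 O) (𝟙 O)).hom.app Y) ≫
      F.map ((reindexId O).hom.app ((reindex (𝟙 O)).obj Y)) = 𝟙 _ := by
    rw [← F.map_comp, ← F.map_id]
    congr 1
  have hx := ConcreteCategory.congr_hom (congrArg Over.Hom.left hid) x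
  have hα := naturality_left α ((reindexId O).hom.app Y) x
  have h2 : (β.app Y).left ((G.map ((reindexId O).hom.app Y)).left ((α.app _).left
      ((F.map ((reindexId O).hom.app ((reindex (𝟙 O)).obj Y))).left
        ((F.map ((reindexComp (𝟙 O) (𝟙 O)).hom.app Y)).left x)))) =
      (β.app Y).left ((α.app Y).left ((F.map ((reindexId O).hom.app Y)).left x)) :=
    congrArg (β.app Y).left ((congrArg (fun y => (G.map ((reindexId O).hom.app Y)).left
      ((α.app _).left y)) hx).trans hα.symm)
  exact reindex_id_ext h2

/-- A natural isomorphism as an isomorphism of `Exp(Set)`. -/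
def fiberIso {F G : Over O ⥤ Over O} (e : F ≅ G) : (⟨O, F⟩ : ExpSet.{u}) ≅ ⟨O, G⟩ where
  hom := fiberHom e.hom
  inv := fiberHom e.inv
  hom_inv_id := by rw [fiberHom_comp, e.hom_inv_id, fiberHom_id]
  inv_hom_id := by rw [fiberHom_comp, e.inv_hom_id, fiberHom_id]

end ExpSet

/-! ### Characterization of the objects and morphisms of `An` -/

theorem anObj_iff (P : ExpSet.{u}) : AnObj P ↔ IsFinitaryWeaklyWide P.functor := by
  constructor
  · rintro ⟨A, ⟨e⟩⟩
    exact ExpSet.isFinitaryWeaklyWide_of_iso e.symm A.sig.isFinitaryWeaklyWide_star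
  · intro h
    obtain ⟨A, ⟨e⟩⟩ := (isAnalytic_iff P.functor).2 h
    exact ⟨⟨P.base, A⟩, ⟨ExpSet.fiberIso e⟩⟩

theorem exists_rep_map_eq_iff (A B : Sig.{u}) (τ : Sig.rep.obj A ⟶ Sig.rep.obj B) :
    (∃ f : A ⟶ B, Sig.rep.map f = τ) ↔ WeaklyCartesian (ExpSet.nat τ) := by
  constructor
  · rintro ⟨f, rfl⟩
    exact SymSig.weaklyCartesian_starHom f.hom
  · intro h
    obtain ⟨v, τ⟩ := τ
    obtain ⟨f, hf⟩ := SymSig.exists_starHom_eq_of_weaklyCartesian (v := v) h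
    exact ⟨⟨v, f⟩, congrArg (ExpSet.Hom.mk v) hf⟩

theorem anHom_iff {P R : ExpSet.{u}} (τ : P ⟶ R) :
    AnHom τ ↔ IsFinitaryWeaklyWide P.functor ∧ IsFinitaryWeaklyWide R.functor ∧
      WeaklyCartesian (ExpSet.nat τ) := by
  constructor
  · rintro ⟨A, B, f, -, ⟨e⟩⟩
    let eP : Sig.rep.obj A ≅ P := Arrow.leftFunc.mapIso e
    let eR : Sig.rep.obj B ≅ R := Arrow.rightFunc.mapIso e
    have hP := ExpSet.isFinitaryWeaklyWide_of_iso eP.symm A.sig.isFinitaryWeaklyWide_star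
    have hR := ExpSet.isFinitaryWeaklyWide_of_iso eR.symm B.sig.isFinitaryWeaklyWide_star
    refine ⟨hP, hR, ?_⟩
    have hτ : τ = eP.inv ≫ Sig.rep.map f ≫ eR.hom := by
      rw [Iso.eq_inv_comp]
      exact e.hom.w
    rw [hτ]
    refine ExpSet.weaklyCartesian_comp _ _ hP.wide (ExpSet.weaklyCartesian_of_iso eP.symm) ?_
    exact ExpSet.weaklyCartesian_comp _ _ A.sig.weaklyPreservesWidePullbacks_star
      (SymSig.weaklyCartesian_starHom f.hom) (ExpSet.weaklyCartesian_of_iso eR)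
  · rintro ⟨hP, hR, hτ⟩
    obtain ⟨A, ⟨eP⟩⟩ := (anObj_iff P).2 hP
    obtain ⟨B, ⟨eR⟩⟩ := (anObj_iff R).2 hR
    obtain ⟨f, hf⟩ := (exists_rep_map_eq_iff A B (eP.hom ≫ τ ≫ eR.inv)).2 (by
      refine ExpSet.weaklyCartesian_comp _ _ A.sig.weaklyPreservesWidePullbacks_star
        (ExpSet.weaklyCartesian_of_iso eP) ?_
      exact ExpSet.weaklyCartesian_comp _ _ hP.wide hτ (ExpSet.weaklyCartesian_of_iso eR.symm))
    refine ⟨A, B, f, trivial, ⟨Arrow.isoMk eP eR ?_⟩⟩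
    change eP.hom ≫ τ = Sig.rep.map f ≫ eR.hom
    rw [hf, Category.assoc, Category.assoc, eR.inv_hom_id, Category.comp_id]

/-! ### Prone morphisms -/

namespace ExpSet

variable {O Q : Type u}

/-- The domain `v^* R v_!` of the prone morphism over `v` with codomain `R`. -/
def proneObj (v : O ⟶ Q) (R : Over Q ⥤ Over Q) : Over O ⥤ Over O :=
  Over.map v ⋙ R ⋙ reindex v

/-- The prone morphism over `v` with codomain `R`, the transformation `v^* R v_! v^* ⟶ v^* R` given by
the counit of `v_! ⊣ v^*`. -/
def proneHom (v : O ⟶ Q) (R : Over Q ⥤ Over Q) :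
    (⟨O, proneObj v R⟩ : ExpSet.{u}) ⟶ ⟨Q, R⟩ :=
  homMk v (Functor.whiskerRight (reindexAdj v).counit (R ⋙ reindex v))

theorem isFinitaryWeaklyWide_proneObj (v : O ⟶ Q) {R : Over Q ⥤ Over Q}
    (hR : IsFinitaryWeaklyWide R) : IsFinitaryWeaklyWide (proneObj v R) :=
  hR.conj ⟨fun _ _ _ => (reindexAdj v).leftAdjoint_preservesColimits.preservesColimitsOfShape⟩
    (weaklyPreservesWidePullbacks_map v)
    (preservesFilteredColimits_reindex v) (weaklyPreservesWidePullbacks_reindex v)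

theorem weaklyCartesian_counit (v : O ⟶ Q) : WeaklyCartesian (reindexAdj v).counit := by
  rw [weaklyCartesian_iff]
  rintro X Y f ⟨⟨o, y⟩, h⟩ x hxy
  obtain rfl : y = f.left x := hxy
  exact ⟨⟨(o, x), h.trans (hom_left_apply f x)⟩, rfl, rfl⟩

theorem weaklyCartesian_proneHom (v : O ⟶ Q) {R : Over Q ⥤ Over Q}
    (hR : WeaklyPreservesWidePullbacks R) : WeaklyCartesian (nat (proneHom v R)) :=
  (weaklyCartesian_counit v).whiskerRight (hR.comp (weaklyPreservesWidePullbacks_reindex v))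

theorem weaklyCartesian_unit (v : O ⟶ Q) : WeaklyCartesian (reindexAdj v).unit := by
  rw [weaklyCartesian_iff]
  rintro X Y f y ⟨⟨o, x⟩, h⟩ hxy
  obtain ⟨ho, rfl⟩ := Prod.mk.inj (Subtype.mk.inj hxy)
  have ho' : X.hom x = o := (hom_left_apply f x).symm.trans ho
  exact ⟨x, rfl, Subtype.ext (Prod.ext ho' rfl)⟩

section Factorization

variable {D : Type u} {T : Over D ⥤ Over D} {R : Over Q ⥤ Over Q} (g : D ⟶ O) (v : O ⟶ Q)

/-- The transformation `T g^* ⟶ T g^* v^* v_! ≅ T (v g)^* v_! ⟶ (v g)^* R v_! ≅ g^* v^* R v_!` through which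
`ν : T (v g)^* ⟶ (v g)^* R` factors over the prone morphism. -/
def proneLift (ν : reindex (g ≫ v) ⋙ T ⟶ R ⋙ reindex (g ≫ v)) :
    reindex g ⋙ T ⟶ proneObj v R ⋙ reindex g :=
  Functor.whiskerRight (reindexAdj v).unit (reindex g ⋙ T) ≫
    Functor.whiskerLeft (Over.map v) (Functor.whiskerRight (reindexComp g v).inv T ≫ ν ≫
      Functor.whiskerLeft R (reindexComp g v).hom)

theorem proneLift_comp (ν : reindex (g ≫ v) ⋙ T ⟶ R ⋙ reindex (g ≫ v)) :
    homMk g (proneLift g v ν) ≫ proneHom v R = homMk (g ≫ v) ν := by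
  refine congrArg (homMk (P := T) (R := R) (g ≫ v)) ?_
  ext1
  ext1 Y
  let ε := (reindexAdj v).counit.app Y
  have hid : T.map ((reindexComp g v).hom.app Y) ≫
      T.map ((reindex g).map ((reindexAdj v).unit.app ((reindex v).obj Y))) ≫
        T.map ((reindexComp g v).inv.app ((Over.map v).obj ((reindex v).obj Y))) ≫
          T.map ((reindex (g ≫ v)).map ε) = 𝟙 _ := by
    rw [← T.map_comp, ← T.map_comp, ← T.map_comp, ← T.map_id]
    congr 1
  refine over_hom_ext fun x => ?_
  have hν := naturality_left ν ε ((T.map ((reindexComp g v).inv.app _)).left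
    ((T.map ((reindex g).map ((reindexAdj v).unit.app ((reindex v).obj Y)))).left
      ((T.map ((reindexComp g v).hom.app Y)).left x)))
  refine Eq.trans ?_ (hν.symm.trans (congrArg (ν.app Y).left
    (ConcreteCategory.congr_hom (congrArg Over.Hom.left hid) x)))
  rfl

/-- The value of `κ : T g^* ⟶ g^* v^* R v_!` at `X` is recovered from its composite with the prone
morphism at `v_! X`. -/
theorem comp_proneHom_app_unit (κ : reindex g ⋙ T ⟶ proneObj v R ⋙ reindex g) {X : Over O}
    (x : (T.obj ((reindex g).obj X)).left) :
    ((reindex g).map ((nat (proneHom v R)).app ((Over.map v).obj X))).left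
      ((κ.app _).left ((T.map ((reindex g).map ((reindexAdj v).unit.app X))).left x)) =
        (κ.app X).left x := by
  have hid : R.map ((Over.map v).map ((reindexAdj v).unit.app X)) ≫
      R.map ((reindexAdj v).counit.app ((Over.map v).obj X)) = 𝟙 _ := by
    rw [← R.map_comp]
    exact (congrArg R.map ((reindexAdj v).left_triangle_components X)).trans (R.map_id _)
  have h := naturality_left κ ((reindexAdj v).unit.app X) x
  refine (congrArg (((reindex g).map ((nat (proneHom v R)).app ((Over.map v).obj X))).left)
    h).trans ?_
  have h' : (reindex g).map ((reindex v).map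
        (R.map ((Over.map v).map ((reindexAdj v).unit.app X)))) ≫
      (reindex g).map ((reindex v).map
        (R.map ((reindexAdj v).counit.app ((Over.map v).obj X)))) = 𝟙 _ := by
    rw [← Functor.map_comp, ← Functor.map_comp, hid, (reindex v).map_id, (reindex g).map_id]
  exact ConcreteCategory.congr_hom (congrArg Over.Hom.left h') ((κ.app X).left x)

/-- A transformation into the domain of the prone morphism is recovered from its composite with it. -/
theorem proneLift_nat_comp (κ : reindex g ⋙ T ⟶ proneObj v R ⋙ reindex g) :
    proneLift g v (nat (homMk g κ ≫ proneHom v R)) = κ := by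
  ext1
  ext1 X
  refine over_hom_ext fun x => ?_
  refine Eq.trans ?_ (comp_proneHom_app_unit g v κ x)
  refine (iso_inv_hom_left ((reindexComp g v).app (R.obj ((Over.map v).obj X))) _).trans ?_
  refine congrArg (((reindex g).map ((nat (proneHom v R)).app ((Over.map v).obj X))).left ∘
    (κ.app ((reindex v).obj ((Over.map v).obj X))).left) ?_
  exact iso_inv_hom_left (T.mapIso ((reindexComp g v).app ((Over.map v).obj X))) _

/-- That a composite `κ ≫ β` and `β` are weakly cartesian does not imply it for `κ` in general. For the prone
morphism in the place of `β` it does, because the naturality squares of the unit `X ⟶ v^* v_! X` are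
weak pullbacks, which `T g^*` preserves. -/
theorem weaklyCartesian_proneLift (hT : WeaklyPreservesWidePullbacks T)
    {ν : reindex (g ≫ v) ⋙ T ⟶ R ⋙ reindex (g ≫ v)} (hν : WeaklyCartesian ν) :
    WeaklyCartesian (proneLift g v ν) := by
  refine .comp ?_ (.whiskerLeft (.comp ?_ (.comp hν ?_)) _)
  · exact (weaklyCartesian_unit v).whiskerRight ((weaklyPreservesWidePullbacks_reindex g).comp hT)
  · exact .whiskerRight (weaklyCartesian_of_isIso _) hT
  · exact .whiskerLeft (weaklyCartesian_of_isIso _) _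

end Factorization

theorem base_eq_of_isHomLift {P R : ExpSet.{u}} {f : proj.obj P ⟶ proj.obj R} {φ : P ⟶ R}
    (_ : proj.IsHomLift f φ) : f = Hom.base φ :=
  IsHomLift.eq_of_isHomLift proj f φ

theorem homMk_injective {P : Over O ⥤ Over O} {R : Over Q ⥤ Over Q} (v : O ⟶ Q) :
    Function.Injective (homMk (P := P) (R := R) v) := fun _ _ h =>
  eq_of_heq (Hom.mk.inj h).2

theorem isStronglyCartesian_proneHom (v : O ⟶ Q) (R : Over Q ⥤ Over Q) :
    proj.IsStronglyCartesian v (proneHom v R) where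
  toIsHomLift := Functor.IsHomLift.map (p := proj) (proneHom v R)
  universal_property' {T} g ψ hψ := by
    obtain ⟨D, T⟩ := T
    have hb : g ≫ v = Hom.base ψ :=
      base_eq_of_isHomLift (P := ⟨D, T⟩) (R := ⟨Q, R⟩) hψ
    obtain ⟨b, ν⟩ := ψ
    obtain rfl : g ≫ v = b := hb
    refine ⟨homMk g (proneLift g v ν), ⟨Functor.IsHomLift.map (p := proj) (homMk g _),
      proneLift_comp g v ν⟩, ?_⟩
    rintro χ ⟨hχ, hχφ⟩
    have hb : g = Hom.base χ :=
      base_eq_of_isHomLift (P := ⟨D, T⟩) (R := ⟨O, proneObj v R⟩) hχ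
    obtain ⟨g', κ⟩ := χ
    obtain rfl : g = g' := hb
    have h : nat (homMk g κ ≫ proneHom v R) = ν := homMk_injective (g ≫ v) hχφ
    refine congrArg (homMk g) ?_
    exact (proneLift_nat_comp g v κ).symm.trans (congrArg (proneLift g v) h)

theorem weaklyCartesian_of_comp_proneHom {T : ExpSet.{u}} (v : O ⟶ Q) {R : Over Q ⥤ Over Q}
    (χ : T ⟶ ⟨O, proneObj v R⟩) (hT : WeaklyPreservesWidePullbacks T.functor)
    (h : WeaklyCartesian (nat (χ ≫ proneHom v R))) : WeaklyCartesian (nat χ) := by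
  obtain ⟨g, κ⟩ := χ
  rw [show κ = _ from (proneLift_nat_comp g v κ).symm]
  exact weaklyCartesian_proneLift g v hT h

end ExpSet

/-! ### The lax monoidal subfibration -/

theorem isLaxMonoidalSubfibration_an :
    IsLaxMonoidalSubfibration.{u} AnObj AnHom where
  source τ h := (anObj_iff _).2 ((anHom_iff τ).1 h).1
  target τ h := (anObj_iff _).2 ((anHom_iff τ).1 h).2.1
  id_mem P h := by
    have hP := (anObj_iff P).1 h
    exact (anHom_iff _).2 ⟨hP, hP, ExpSet.weaklyCartesian_of_iso (Iso.refl P)⟩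
  comp_mem τ σ hτ hσ := by
    rw [anHom_iff] at *
    exact ⟨hτ.1, hσ.2.1, ExpSet.weaklyCartesian_comp τ σ hτ.1.wide hτ.2.2 hσ.2.2⟩
  prone R hR O v := by
    obtain ⟨Q, R⟩ := R
    have hR' : IsFinitaryWeaklyWide R := (anObj_iff _).1 hR
    refine ⟨_, ExpSet.proneHom v R, ExpSet.isStronglyCartesian_proneHom v R,
      (anHom_iff _).2 ⟨ExpSet.isFinitaryWeaklyWide_proneObj v hR', hR',
        ExpSet.weaklyCartesian_proneHom v hR'.wide⟩, fun T χ h => ?_⟩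
    obtain ⟨hT, -, h⟩ := (anHom_iff _).1 h
    exact (anHom_iff _).2 ⟨hT, ExpSet.isFinitaryWeaklyWide_proneObj v hR',
      ExpSet.weaklyCartesian_of_comp_proneHom v χ hT.wide h⟩
  tensor_obj P P' hP hP' :=
    (anObj_iff _).2 (((anObj_iff _).1 hP).comp ((anObj_iff _).1 hP'))
  tensor_hom := by
    intro O Q v P P' R R' σ τ hσ hτ
    obtain ⟨hP, hR, hσ⟩ := (anHom_iff _).1 hσ
    obtain ⟨hP', hR', hτ⟩ := (anHom_iff _).1 hτ
    refine (anHom_iff _).2 ⟨hP.comp hP', hR.comp hR', ?_⟩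
    exact .comp (.whiskerRight hτ hP.wide) (.whiskerLeft hσ _)
  unit_obj O := (anObj_iff _).2 (isFinitaryWeaklyWide_id O)
  unit_hom v := (anHom_iff _).2 ⟨isFinitaryWeaklyWide_id _, isFinitaryWeaklyWide_id _,
    weaklyCartesian_of_isIso (𝟙 (reindex v))⟩

end MultiAnalytic

theorem theorem5 :
    -- An endofunctor of a slice is analytic iff it is finitary and weakly preserves wide pullbacks.
    (∀ (O : Type u) (F : Over O ⥤ Over O),
      MultiAnalytic.IsAnalytic F ↔ MultiAnalytic.IsFinitaryWeaklyWide F) ∧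
    (∀ P : MultiAnalytic.ExpSet.{u},
      MultiAnalytic.AnObj P ↔ MultiAnalytic.IsFinitaryWeaklyWide P.functor) ∧
    -- The transformations `rep_s (f)` between functors `A ⋆ (-)` are the weakly cartesian ones.
    (∀ (A B : MultiAnalytic.Sig.{u})
        (τ : MultiAnalytic.Sig.rep.obj A ⟶ MultiAnalytic.Sig.rep.obj B),
      (∃ f : A ⟶ B, MultiAnalytic.Sig.rep.map f = τ) ↔
        MultiAnalytic.WeaklyCartesian (MultiAnalytic.ExpSet.nat τ)) ∧
    (∀ (P R : MultiAnalytic.ExpSet.{u}) (τ : P ⟶ R),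
      MultiAnalytic.AnHom τ ↔
        MultiAnalytic.IsFinitaryWeaklyWide P.functor ∧
        MultiAnalytic.IsFinitaryWeaklyWide R.functor ∧
        MultiAnalytic.WeaklyCartesian (MultiAnalytic.ExpSet.nat τ)) ∧
    -- `An` is a lax monoidal fibration with the structure inherited from `Exp(Set)`.
    MultiAnalytic.IsLaxMonoidalSubfibration.{u} MultiAnalytic.AnObj MultiAnalytic.AnHom :=
  ⟨fun _ F => MultiAnalytic.isAnalytic_iff F, MultiAnalytic.anObj_iff,
    MultiAnalytic.exists_rep_map_eq_iff, fun _ _ τ => MultiAnalytic.anHom_iff τ,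
    MultiAnalytic.isLaxMonoidalSubfibration_an⟩
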